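/- For $d\ge 2$ consider site percolation on $\mathbb Z^d=\mathbb Z^{d-1}\times\mathbb Z$: each site is open with probability $p\in[0,1]$ and closed otherwise, independently of the other sites; write $\mathbb P_p$ for its law. A function $F:\mathbb Z^{d-1}\to\{1,2,\dots\}$ is called Lipschitz if $|F(x)-F(y)|\le 1$ whenever $\|x-y\|_1=1$, and open if the site $(x,F(x))$ is open for every $x\in\mathbb Z^{d-1}$. Let $p_L(d)$ be the infimum of the $p\in[0,1]$ for which $\mathbb P_p(\text{there exists an open Lipschitz function})=1$. Let $\Lambda$ be the oriented graph with vertex set $\mathbb Z^2$ that has an oriented bond from $u$ to $v$ if and only if $v-u\in\{e_1,\,e_1+e_2,\,e_1-e_2\}$, where $e_1,e_2$ are the standard basis vectors. Let $p_{\mathrm{alt}}$ be the critical probability of oriented site percolation on $\Lambda$, that is, the supremum of the $p\in[0,1]$ such that, when the sites of $\mathbb Z^2$ are independently open with probability $p$, the probability that the origin is the starting point of an infinite oriented path of $\Lambda$ all of whose sites (including the origin) are open equals $0$. Then $$p_L(2)=p_{\mathrm{alt}},\qquad\text{and}\qquad \tfrac12\le p_{\mathrm{alt}}\le 0.7491 .$$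 -/

import Mathlib

open MeasureTheory ProbabilityTheory

noncomputable section

namespace LipschitzPercolation

/-! ### Site percolation -/

/-- A configuration of site percolation on the vertex set `V`: the site `v` is open if
`ω v = true`, and closed if `ω v = false`. -/
abbrev Config (V : Type) : Type := V → Bool

/-- The law `P_p` of site percolation with parameter `p ∈ [0,1]` on `V`: the sites are open with
probability `p`, independently of each other. -/
def siteLaw (V : Type) (p : unitInterval) : Measure (Config V) :=
  Measure.infinitePi fun _ : V => bernoulliMeasure true false p

/-! ### Lipschitz percolation -/

/-- The `ℓ¹`-norm on `ℤⁿ`. -/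
def l1norm {n : ℕ} (x : Fin n → ℤ) : ℤ := ∑ i, |x i|

/-- Lipschitz functions from `ℤⁿ` to the positive integers: the values at sites at `ℓ¹`-distance
`1` differ by at most `1`. -/
def IsLipschitzFn {n : ℕ} (F : (Fin n → ℤ) → ℤ) : Prop :=
  (∀ x, 0 < F x) ∧ ∀ x y, l1norm (x - y) = 1 → |F x - F y| ≤ 1

/-- The event that there is an open Lipschitz function, for site percolation on `ℤ^d`. The lattice
`ℤ^d` is written as `ℤ^(d-1) × ℤ`, the last coordinate being the height. It is meant for
`d ≥ 2`. -/
def lipEvent (d : ℕ) : Set (Config ((Fin (d - 1) → ℤ) × ℤ)) :=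
  {ω | ∃ F : (Fin (d - 1) → ℤ) → ℤ, IsLipschitzFn F ∧ ∀ x, ω (x, F x) = true}

/-- The critical probability `p_L(d)` of Lipschitz percolation on `ℤ^d`: the infimum of the
`p ∈ [0,1]` for which an open Lipschitz function exists almost surely. -/
def pL (d : ℕ) : ℝ :=
  sInf ((fun p : unitInterval => (p : ℝ)) ''
    {p | siteLaw ((Fin (d - 1) → ℤ) × ℤ) p (lipEvent d) = 1})

/-! ### Oriented site percolation -/

/-- The event that `v` is the starting point of an infinite open oriented (self-avoiding) path of
the oriented graph `G`. -/
def infinitePathEvent {V : Type} (G : Digraph V) (v : V) : Set (Config V) :=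
  {ω | ∃ γ : ℕ → V, Function.Injective γ ∧ γ 0 = v ∧ (∀ n, G.Adj (γ n) (γ (n + 1))) ∧
    ∀ n, ω (γ n) = true}

/-- The critical probability of oriented site percolation on `G` started from the site `v`: the
supremum of the `p ∈ [0,1]` for which there is almost surely no infinite open oriented path
from `v`. -/
def orientedCriticalProb {V : Type} (G : Digraph V) (v : V) : ℝ :=
  sSup ((fun p : unitInterval => (p : ℝ)) '' {p | siteLaw V p (infinitePathEvent G v) = 0})

/-- The oriented graph on `ℤ²` with an oriented bond from `u` to `v` if and only if
`v - u ∈ {e₁, e₁ + e₂, e₁ - e₂}`. -/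
def altLattice : Digraph (ℤ × ℤ) where
  Adj u v := v - u ∈ ({(1, 0), (1, 1), (1, -1)} : Set (ℤ × ℤ))

/-- The critical probability of oriented site percolation on `altLattice`. The graph is invariant
under translations, so that the choice of the origin as the starting point does not matter. -/
def pAlt : ℝ := orientedCriticalProb altLattice (0, 0)

end LipschitzPercolation

end

noncomputable section

namespace LipschitzPercolation

open scoped ENNReal

/-! ### Product laws -/

/-! Everything is controlled by one process: the highest site `edge` reached after `n` columns by
open oriented paths started from a half-line. Restarting from the half-line below the edge can only
help, so the displacement is subadditive with independent increments, and its mean `meanEdge p n`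
decides both problems.

If some mean is negative, subadditivity and an exponential moment make it exponentially unlikely
that the edge is nonnegative (`edge_large_deviation`). A path from the origin lies below the edge
and above the edge of the reflected process, so it dies. Hence percolation at `p` forces all means
at `p` to be nonnegative.

Sprinkling then gains speed (`meanEdge_add_le`). When density is added column by column, the site
just above the edge becomes open with probability `p' - p`. This gains at least what is gained by
raising a half-line by one, which is exactly one on average by translation invariance. So
percolation at `p` gives a speed of at least `p' - p` at every `p' > p`.

Positive speed yields Lipschitz functions by renormalisation. The edge concentrates around its
asymptotic speed, so large blocks are crossed upwards, or by reflection downwards, with probability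
near one. A Peierls argument finds a Lipschitz function of good blocks. Consecutive blocks are
crossed in opposite directions, so their paths can be glued by alternating maxima and minima.
Conversely, the right half of the graph of an open Lipschitz function is an infinite open path, and
countability of its starting heights gives percolation. Together these identify the critical values.

For the lower bound, one step has mean `1 - (1 - p) / p`, which is negative for `p < 1/2`. For the
upper bound, consider ladders that climb closed sites and lose one unit of height at each move to a
neighbouring column. If they are bounded above the origin, the sites just above their upper envelope
form an open Lipschitz function. Otherwise ladders without repeated sites reach every height. Such a
ladder with `k` moves ending at height `h` uses at least `k + h` closed sites and `k` open sites on
top of its climbs, and a reversal of direction forces a climb of length at least 3. Summing over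
codes of ladders (`ae_mem_lipschitzEvent`) gives existence above `0.7491`. The same argument serves
for the blocks. -/

/-- The law of a configuration in which the site `v` is open with probability `b v`, independently
of the other sites. -/
def productLaw {V : Type} (b : V → unitInterval) : Measure (Config V) :=
  Measure.infinitePi fun v : V => bernoulliMeasure true false (b v)

instance {V : Type} (b : V → unitInterval) : IsProbabilityMeasure (productLaw b) := by
  unfold productLaw; infer_instance

lemma siteLaw_eq (V : Type) (p : unitInterval) : siteLaw V p = productLaw fun _ => p := rfl

instance (V : Type) (p : unitInterval) : IsProbabilityMeasure (siteLaw V p) := by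
  rw [siteLaw_eq]; infer_instance

lemma bernoulli_true (p : unitInterval) :
    bernoulliMeasure true false p {true} = ENNReal.ofReal p := by
  rw [bernoulliMeasure_apply_of_mem_of_notMem p (by measurability) (by simp) (by simp)]
  rw [ENNReal.ofReal]
  congr 1
  ext; simp [p.2.1]

lemma bernoulli_false (p : unitInterval) :
    bernoulliMeasure true false p {false} = ENNReal.ofReal (1 - p) := by
  rw [bernoulliMeasure_apply_of_notMem_of_mem p (by measurability) (by simp) (by simp)]
  rw [ENNReal.ofReal]
  congr 1
  ext; simp [unitInterval.coe_symm_eq, p.2.2]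

variable {V W : Type}

lemma productLaw_map_injective (b : V → unitInterval) {f : W → V} (hf : Function.Injective f) :
    (productLaw b).map (fun ω w => ω (f w)) = productLaw fun w => b (f w) :=
  Measure.map_infinitePi_infinitePi_of_inj hf

lemma productLaw_cylinder (b : V → unitInterval) (S T : Finset V) (h : Disjoint S T) :
    productLaw b {ω | (∀ v ∈ S, ω v = false) ∧ ∀ v ∈ T, ω v = true} =
      (∏ v ∈ S, ENNReal.ofReal (1 - b v)) * ∏ v ∈ T, ENNReal.ofReal (b v) := by
  classical
  have : {ω : Config V | (∀ v ∈ S, ω v = false) ∧ ∀ v ∈ T, ω v = true} =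
      Set.pi ((S ∪ T : Finset V) : Set V) (fun v => if v ∈ S then {false} else {true}) := by
    ext ω
    simp only [Set.mem_ofPred_eq, Set.mem_pi, Finset.coe_union, Set.mem_union, Finset.mem_coe]
    constructor
    · rintro ⟨h1, h2⟩ v hv
      by_cases hS : v ∈ S
      · simp [hS, h1 v hS]
      · simp [hS, h2 v (hv.resolve_left hS)]
    · intro H
      refine ⟨fun v hv => ?_, fun v hv => ?_⟩
      · simpa [hv] using H v (Or.inl hv)
      · have : v ∉ S := fun h' => Finset.disjoint_left.1 h h' hv
        simpa [this] using H v (Or.inr hv)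
  rw [this, productLaw, Measure.infinitePi_pi _ (fun _ _ => MeasurableSet.of_discrete),
    Finset.prod_union h]
  congr 1
  · exact Finset.prod_congr rfl fun v hv => by rw [if_pos hv, bernoulli_false]
  · refine Finset.prod_congr rfl fun v hv => ?_
    rw [if_neg fun h' => Finset.disjoint_left.1 h h' hv, bernoulli_true]

lemma siteLaw_cylinder (p : unitInterval) (S T : Finset V) (h : Disjoint S T) :
    siteLaw V p {ω | (∀ v ∈ S, ω v = false) ∧ ∀ v ∈ T, ω v = true} =
      ENNReal.ofReal (1 - p) ^ S.card * ENNReal.ofReal p ^ T.card := by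
  rw [siteLaw_eq, productLaw_cylinder _ _ _ h, Finset.prod_const, Finset.prod_const]

/-- Replacing the configuration outside `S` by closed sites. -/
def closeOutside (S : Set V) (ω : Config V) : Config V := by
  classical exact fun v => if v ∈ S then ω v else false

/-- Turns `DependsOn` into measurability: a measurable function of the states in `S` factors through
`closeOutside S`, which is measurable for the σ-algebra generated by those states. -/
lemma comp_closeOutside {β : Type*} {f : Config V → β} {S : Set V} (hf : DependsOn f S) :
    f ∘ closeOutside S = f := by
  funext ω
  exact hf fun v hv => by simp [closeOutside, hv]

lemma measurable_closeOutside (S : Set V) :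
    Measurable[⨆ v ∈ S, MeasurableSpace.comap (fun ω : Config V => ω v) inferInstance]
      (closeOutside S) := by
  refine @measurable_pi_lambda _ _ _ (_) _ _ fun v => ?_
  by_cases hv : v ∈ S
  · have : (fun ω : Config V => closeOutside S ω v) = fun ω => ω v := by
      funext ω; simp [closeOutside, hv]
    rw [this]
    exact Measurable.of_comap_le
      (le_iSup₂_of_le (f := fun v (_ : v ∈ S) =>
        MeasurableSpace.comap (fun ω : Config V => ω v) inferInstance) v hv le_rfl)
  · have : (fun ω : Config V => closeOutside S ω v) = fun _ => false := by
      funext ω; simp [closeOutside, hv]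
    rw [this]
    exact @measurable_const _ _ _ (_) _

lemma indep_productLaw (b : V → unitInterval) {S T : Set V} (h : Disjoint S T) :
    Indep (⨆ v ∈ S, MeasurableSpace.comap (fun ω : Config V => ω v) inferInstance)
      (⨆ v ∈ T, MeasurableSpace.comap (fun ω : Config V => ω v) inferInstance)
      (productLaw b) := by
  refine indep_iSup_of_disjoint (fun v => (measurable_pi_apply v).comap_le) ?_ h
  exact iIndepFun_infinitePi (P := fun v : V => bernoulliMeasure true false (b v))
    (X := fun _ x => x) fun _ => measurable_id

/-- Functions of the states of disjoint sets of sites are independent. -/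
lemma indepFun_of_dependsOn (b : V → unitInterval) {β γ : Type*} [MeasurableSpace β]
    [MeasurableSpace γ] {f : Config V → β} {g : Config V → γ} (hf : Measurable f)
    (hg : Measurable g) {S T : Set V} (hfS : DependsOn f S) (hgT : DependsOn g T)
    (h : Disjoint S T) : IndepFun f g (productLaw b) := by
  have h1 := indep_productLaw b h
  refine indep_of_indep_of_le_left (indep_of_indep_of_le_right h1 ?_) ?_
  · rw [← comp_closeOutside hgT]
    exact (hg.comp (measurable_closeOutside T)).comap_le
  · rw [← comp_closeOutside hfS]
    exact (hf.comp (measurable_closeOutside S)).comap_le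

lemma lintegral_mul_of_dependsOn (b : V → unitInterval) {f g : Config V → ℝ≥0∞}
    (hf : Measurable f) (hg : Measurable g) {S T : Set V} (hfS : DependsOn f S)
    (hgT : DependsOn g T) (h : Disjoint S T) :
    ∫⁻ ω, f ω * g ω ∂productLaw b = (∫⁻ ω, f ω ∂productLaw b) * ∫⁻ ω, g ω ∂productLaw b :=
  lintegral_mul_eq_lintegral_mul_lintegral_of_indepFun'' hf.aemeasurable hg.aemeasurable
    (indepFun_of_dependsOn b hf hg hfS hgT h)

lemma measure_inter_of_dependsOn (b : V → unitInterval) {A B : Set (Config V)}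
    (hA : MeasurableSet A) (hB : MeasurableSet B) {S T : Set V}
    (hAS : DependsOn (fun ω => ω ∈ A) S) (hBT : DependsOn (fun ω => ω ∈ B) T)
    (h : Disjoint S T) : productLaw b (A ∩ B) = productLaw b A * productLaw b B := by
  classical
  have := lintegral_mul_of_dependsOn b (f := A.indicator 1) (g := B.indicator 1)
    (measurable_one.indicator hA) (measurable_one.indicator hB)
    (fun x y hxy => if_congr (iff_of_eq (hAS hxy)) rfl rfl)
    (fun x y hxy => if_congr (iff_of_eq (hBT hxy)) rfl rfl) h
  rw [lintegral_indicator_one hA, lintegral_indicator_one hB] at this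
  rw [← this, ← lintegral_indicator_one (hA.inter hB)]
  simp [Set.inter_indicator_one]

/-- The expectation of a function whose index is chosen by an independent random integer. -/
lemma lintegral_randomIndex (b : V → unitInterval) {X : Config V → ℤ}
    {Y : ℤ → Config V → ℝ≥0∞} (hX : Measurable X) (hY : ∀ h, Measurable (Y h)) {S T : Set V}
    (hXS : DependsOn X S) (hYT : ∀ h, DependsOn (Y h) T) (hST : Disjoint S T) :
    ∫⁻ ω, Y (X ω) ω ∂productLaw b =
      ∑' h, productLaw b (X ⁻¹' {h}) * ∫⁻ ω, Y h ω ∂productLaw b := by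
  have h1 : ∀ ω, Y (X ω) ω = ∑' h, (X ⁻¹' {h}).indicator 1 ω * Y h ω := by
    intro ω
    rw [tsum_eq_single (X ω)]
    · simp
    · intro h hh
      have : ω ∉ X ⁻¹' {h} := by simpa using hh.symm
      simp [this]
  simp_rw [h1]
  have hm : ∀ h, MeasurableSet (X ⁻¹' {h}) := fun h => hX (MeasurableSet.singleton h)
  rw [lintegral_tsum (f := fun h ω => (X ⁻¹' {h}).indicator 1 ω * Y h ω) fun h =>
    ((measurable_one.indicator (hm h)).mul (hY h)).aemeasurable]
  refine tsum_congr fun h => ?_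
  rw [lintegral_mul_of_dependsOn b (measurable_one.indicator (hm h)) (hY h) ?_ (hYT h) hST,
    lintegral_indicator_one (hm h)]
  intro x y hxy
  have := hXS hxy
  simp only [Set.indicator, Set.mem_preimage, this, Pi.one_apply]

lemma tsum_measure_fiber (μ : Measure (Config V)) [IsProbabilityMeasure μ] {X : Config V → ℤ}
    (hX : Measurable X) : ∑' h, μ (X ⁻¹' {h}) = 1 := by
  rw [← measure_iUnion (fun i j hij => ?_) fun h => hX (MeasurableSet.singleton h)]
  · have : (⋃ i, X ⁻¹' {i}) = Set.univ := by ext; simp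
    rw [this, measure_univ]
  · exact Set.disjoint_left.2 fun x hx hy => hij (by simp_all)

/-- Opening the sites of a configuration of parameter `p` that are open in an independent
configuration of parameter `s`. -/
lemma productLaw_map_or (p s p' : unitInterval) (h : (1 - p : ℝ) * (1 - s) = 1 - p') :
    (productLaw fun v : V × Bool => if v.2 then s else p).map
      (fun ω v => ω (v, false) || ω (v, true)) = siteLaw V p' := by
  set ν := productLaw fun v : V × Bool => if v.2 then s else p with hν
  have hf : Measurable fun (ω : Config (V × Bool)) (v : V) => ω (v, false) || ω (v, true) :=
    measurable_pi_lambda _ fun v =>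
      Measurable.comp (g := fun x : Bool × Bool => x.1 || x.2)
        (f := fun ω : Config (V × Bool) => (ω (v, false), ω (v, true))) (measurable_of_finite _)
        ((measurable_pi_apply (v, false)).prodMk (measurable_pi_apply (v, true)))
  have hfalse : ∀ v : V, ν {ω | (ω (v, false) || ω (v, true)) = false} =
      ENNReal.ofReal (1 - p') := by
    intro v
    classical
    have := productLaw_cylinder (fun v : V × Bool => if v.2 then s else p)
      {(v, false), (v, true)} ∅ (by simp)
    rw [Finset.prod_pair (by simp)] at this
    simp only [Finset.mem_insert, Finset.mem_singleton, Finset.notMem_empty, false_imp_iff,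
      implies_true, and_true, forall_eq_or_imp, forall_eq, Finset.prod_empty, mul_one,
      Bool.false_eq_true, if_false, if_true] at this
    simp only [Bool.or_eq_false_iff]
    rw [hν, this, ← ENNReal.ofReal_mul (by linarith [p.2.2]), h]
  have hsite : ∀ v : V, ν.map (fun ω => ω (v, false) || ω (v, true)) =
      bernoulliMeasure true false p' := by
    intro v
    have hm : Measurable fun ω : Config (V × Bool) => ω (v, false) || ω (v, true) :=
      (measurable_pi_apply v).comp hf
    have := Measure.isProbabilityMeasure_map (μ := ν) hm.aemeasurable
    have e1 : (ν.map (fun ω => ω (v, false) || ω (v, true))) {false} =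
        bernoulliMeasure true false p' {false} := by
      rw [Measure.map_apply hm (by measurability), bernoulli_false, ← hfalse v]
      rfl
    refine Measure.ext_of_singleton fun x => ?_
    cases x
    · exact e1
    · have hc : ({true} : Set Bool) = {false}ᶜ := by ext x; cases x <;> simp
      rw [hc, prob_compl_eq_one_sub (by measurability), prob_compl_eq_one_sub (by measurability),
        e1]
  refine Measure.eq_infinitePi _ fun S t ht => ?_
  rw [Measure.map_apply hf (MeasurableSet.pi S.countable_toSet fun _ _ => ht _)]
  classical
  induction S using Finset.induction_on with
  | empty => simp
  | insert v S hv ih =>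
    rw [Finset.prod_insert hv, ← ih, Finset.coe_insert, Set.insert_pi, Set.preimage_inter,
      ← hsite v]
    rw [Measure.map_apply (f := fun ω : Config (V × Bool) => ω (v, false) || ω (v, true))
      ((measurable_pi_apply v).comp hf) (ht v)]
    refine measure_inter_of_dependsOn _ (S := {v} ×ˢ Set.univ) (T := (S : Set V) ×ˢ Set.univ)
      (((measurable_pi_apply v).comp hf) (ht v))
      (hf (MeasurableSet.pi S.countable_toSet fun _ _ => ht _)) ?_ ?_ ?_
    · intro x y hxy
      simp [hxy (v, false) (by simp), hxy (v, true) (by simp)]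
    · intro x y hxy
      simp only [Set.mem_preimage, Set.mem_pi, eq_iff_iff]
      refine forall₂_congr fun w hw => ?_
      rw [hxy (w, false) (by simpa using hw), hxy (w, true) (by simpa using hw)]
    · rw [Set.disjoint_left]
      rintro ⟨w, c⟩ h1 h2
      simp only [Set.mem_prod, Set.mem_singleton_iff, Set.mem_univ, and_true,
        Finset.mem_coe] at h1 h2
      exact hv (h1 ▸ h2)

/-! ### The oriented process started from a half-line -/

/-- The heights of the sites in the column `s + n` that are reached by open oriented paths from the
half-line of the sites of height at most `h` in the column `s`, which need not be open. -/
def wet (ω : Config (ℤ × ℤ)) (s h : ℤ) : ℕ → Set ℤ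
  | 0 => {y | y ≤ h}
  | n + 1 => {y | ω (s + n + 1, y) = true ∧ ∃ z ∈ wet ω s h n, |y - z| ≤ 1}

/-- The height of the highest site reached in the column `s + n`. -/
def edge (ω : Config (ℤ × ℤ)) (s h : ℤ) (n : ℕ) : ℤ := sSup (wet ω s h n)

/-- The columns `a + 1, …, b`. -/
def columns (a b : ℤ) : Set (ℤ × ℤ) := {v | a < v.1 ∧ v.1 ≤ b}

/-- The configuration seen from the site `(a, b)`. -/
def shift (a b : ℤ) (ω : Config (ℤ × ℤ)) : Config (ℤ × ℤ) := fun v => ω (v.1 + a, v.2 + b)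

section Deterministic

variable {ω ω' : Config (ℤ × ℤ)} {s h h' y : ℤ} {m n : ℕ}

lemma wet_le (hy : y ∈ wet ω s h n) : y ≤ h + n := by
  induction n generalizing y with
  | zero => simpa [wet] using hy
  | succ n ih =>
    obtain ⟨-, z, hz, hyz⟩ := hy
    have := ih hz
    rw [abs_le] at hyz
    push_cast
    linarith

lemma wet_mono_height (hh : h ≤ h') : wet ω s h n ⊆ wet ω s h' n := by
  induction n with
  | zero => exact fun y hy => le_trans hy hh
  | succ n ih =>
    rintro y ⟨hy, z, hz, hyz⟩
    exact ⟨hy, z, ih hz, hyz⟩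

lemma wet_mono_config (hω : ∀ v, ω v = true → ω' v = true) : wet ω s h n ⊆ wet ω' s h n := by
  induction n with
  | zero => exact fun y hy => hy
  | succ n ih =>
    rintro y ⟨hy, z, hz, hyz⟩
    exact ⟨hω _ hy, z, ih hz, hyz⟩

lemma wet_congr (hω : ∀ v ∈ columns s (s + n), ω v = ω' v) : wet ω s h n = wet ω' s h n := by
  induction n with
  | zero => rfl
  | succ n ih =>
    have e := ih fun v hv => hω v ⟨hv.1, hv.2.trans (by push_cast; linarith)⟩
    ext y
    simp only [wet, Set.mem_ofPred_eq, e]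
    rw [hω (s + n + 1, y) ⟨by simp only; linarith [Int.natCast_nonneg n], by push_cast; linarith⟩]

lemma edge_congr (hω : ∀ v ∈ columns s (s + n), ω v = ω' v) : edge ω s h n = edge ω' s h n := by
  rw [edge, edge, wet_congr hω]

lemma bddAbove_wet : BddAbove (wet ω s h n) := ⟨h + n, fun _ => wet_le⟩

lemma le_edge (hy : y ∈ wet ω s h n) : y ≤ edge ω s h n := le_csSup bddAbove_wet hy

lemma edge_mem (hne : (wet ω s h n).Nonempty) : edge ω s h n ∈ wet ω s h n :=
  Int.csSup_mem hne bddAbove_wet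

lemma edge_le (hne : (wet ω s h n).Nonempty) : edge ω s h n ≤ h + n := wet_le (edge_mem hne)

@[simp] lemma edge_zero : edge ω s h 0 = h := csSup_Iic

/-- Every site wet in column `s + m` lies at or below the edge there, so replacing the wet set by
the full half-line below the edge only adds paths. -/
lemma wet_add :
    wet ω s h (m + n) ⊆ wet ω (s + m) (edge ω s h m) n := by
  induction n with
  | zero => exact fun y hy => le_edge hy
  | succ n ih =>
    rintro y ⟨hy, z, hz, hyz⟩
    refine ⟨?_, z, ih hz, hyz⟩
    have hy' : ω (s + (m + n : ℕ) + 1, y) = true := hy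
    rw [← hy']
    congr 2
    push_cast
    ring

/-- The subadditivity behind all the estimates. The restarted process uses only columns to the right
of `s + m`, hence is independent of the height from which it restarts. -/
lemma edge_add_le (hmn : (wet ω s h (m + n)).Nonempty) :
    edge ω s h (m + n) ≤ edge ω (s + m) (edge ω s h m) n :=
  le_edge (wet_add (edge_mem hmn))

lemma edge_mono_height (hh : h ≤ h') (hne : (wet ω s h n).Nonempty) :
    edge ω s h n ≤ edge ω s h' n := le_edge (wet_mono_height hh (edge_mem hne))

lemma edge_mono_config (hω : ∀ v, ω v = true → ω' v = true) (hne : (wet ω s h n).Nonempty) :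
    edge ω s h n ≤ edge ω' s h n := le_edge (wet_mono_config hω (edge_mem hne))

lemma mem_wet_shift (a b : ℤ) : y ∈ wet (shift a b ω) s h n ↔ y + b ∈ wet ω (s + a) (h + b) n := by
  induction n generalizing y with
  | zero => simp [wet]
  | succ n ih =>
    have e : s + n + 1 + a = s + a + n + 1 := by ring
    simp only [wet, shift, Set.mem_ofPred_eq, e, ih]
    refine and_congr_right fun _ => ⟨?_, ?_⟩
    · rintro ⟨z, hz, hyz⟩
      exact ⟨z + b, hz, by simpa using hyz⟩
    · rintro ⟨z, hz, hyz⟩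
      exact ⟨z - b, by simpa using hz, by rwa [show y - (z - b) = y + b - z by ring]⟩

lemma edge_shift (a b : ℤ) (hne : (wet ω (s + a) (h + b) n).Nonempty) :
    edge (shift a b ω) s h n = edge ω (s + a) (h + b) n - b := by
  have hne' : (wet (shift a b ω) s h n).Nonempty := by
    obtain ⟨y, hy⟩ := hne
    exact ⟨y - b, (mem_wet_shift a b).2 (by simpa using hy)⟩
  apply le_antisymm
  · have := le_edge ((mem_wet_shift a b).1 (edge_mem hne'))
    linarith
  · refine le_edge ((mem_wet_shift a b).2 ?_)
    simpa using edge_mem hne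

/-- The heights reached are the end points of the open oriented paths. -/
lemma mem_wet_iff : y ∈ wet ω s h n ↔ ∃ f : ℕ → ℤ, f 0 ≤ h ∧ f n = y ∧
    ∀ i < n, |f (i + 1) - f i| ≤ 1 ∧ ω (s + i + 1, f (i + 1)) = true := by
  constructor
  · intro hy
    induction n generalizing y with
    | zero => exact ⟨fun _ => y, hy, rfl, by simp⟩
    | succ n ih =>
      obtain ⟨hy, z, hz, hyz⟩ := hy
      obtain ⟨f, hf0, hfn, hf⟩ := ih hz
      refine ⟨fun i => if i ≤ n then f i else y, by simpa using hf0, by simp, fun i hi => ?_⟩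
      rcases (Nat.lt_succ_iff.1 hi).lt_or_eq with hi | rfl
      · simpa [hi.le, Nat.succ_le_of_lt hi] using hf i hi
      · simpa [hfn] using ⟨hyz, hy⟩
  · rintro ⟨f, hf0, rfl, hf⟩
    induction n with
    | zero => exact hf0
    | succ n ih =>
      exact ⟨(hf n (by simp)).2, f n, ih fun i hi => hf i (hi.trans (by simp)), (hf n (by simp)).1⟩

lemma dependsOn_edge (s h : ℤ) (n : ℕ) :
    DependsOn (fun ω => edge ω s h n) (columns s (s + n)) := fun _ _ hxy => edge_congr hxy

end Deterministic

/-! ### Measurability of the oriented process -/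

lemma measurableSet_isOpen {V : Type} (v : V) : MeasurableSet {ω : Config V | ω v = true} :=
  measurableSet_eq_fun (measurable_pi_apply v) measurable_const

lemma measurableSet_mem_wet (s h y : ℤ) (n : ℕ) : MeasurableSet {ω | y ∈ wet ω s h n} := by
  induction n generalizing y with
  | zero => simp only [wet, Set.mem_ofPred_eq]; exact MeasurableSet.const _
  | succ n ih =>
    have : {ω | y ∈ wet ω s h (n + 1)} = {ω | ω (s + n + 1, y) = true} ∩
        ⋃ z, ⋃ _ : |y - z| ≤ 1, {ω | z ∈ wet ω s h n} := by
      ext ω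
      simp only [wet, Set.mem_ofPred_eq, Set.mem_inter_iff, Set.mem_iUnion, exists_prop]
      exact and_congr_right fun _ => exists_congr fun z => and_comm
    rw [this]
    refine MeasurableSet.inter ?_ (MeasurableSet.iUnion fun z => MeasurableSet.iUnion fun _ => ih z)
    exact measurableSet_isOpen _

/-- The supremum of the empty set in `ℤ` is 0, so the fibre over 0 cannot be described by membership
in the wet set. It is the complement of all other fibres. -/
lemma measurable_edge (s h : ℤ) (n : ℕ) : Measurable fun ω => edge ω s h n := by
  have key : ∀ y : ℤ, y ≠ 0 → MeasurableSet {ω | edge ω s h n = y} := by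
    intro y hy
    have : {ω | edge ω s h n = y} =
        {ω | y ∈ wet ω s h n} ∩ ⋂ z, ⋂ _ : y < z, {ω | z ∈ wet ω s h n}ᶜ := by
      ext ω
      simp only [Set.mem_ofPred_eq, Set.mem_inter_iff, Set.mem_iInter, Set.mem_compl_iff]
      constructor
      · rintro rfl
        have hne : (wet ω s h n).Nonempty := by
          by_contra hne
          rw [Set.not_nonempty_iff_eq_empty] at hne
          exact hy (by rw [edge, hne]; exact Int.csSup_empty)
        exact ⟨edge_mem hne, fun z hz hz' => absurd (le_edge hz') (not_le.2 hz)⟩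
      · rintro ⟨h1, h2⟩
        refine le_antisymm ?_ (le_edge h1)
        by_contra hlt
        exact h2 _ (not_le.1 hlt) (edge_mem ⟨y, h1⟩)
    rw [this]
    exact (measurableSet_mem_wet s h y n).inter (MeasurableSet.iInter fun z =>
      MeasurableSet.iInter fun _ => (measurableSet_mem_wet s h z n).compl)
  refine measurable_to_countable' fun y => ?_
  by_cases hy : y = 0
  · have : (fun ω => edge ω s h n) ⁻¹' {y} = (⋃ z, ⋃ _ : z ≠ 0, {ω | edge ω s h n = z})ᶜ := by
      ext ω
      simp only [hy, Set.mem_preimage, Set.mem_singleton_iff, Set.mem_compl_iff, Set.mem_iUnion,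
        Set.mem_ofPred_eq, exists_prop, not_exists, not_and]
      exact ⟨fun h0 i hi h' => hi (h'.symm.trans h0), fun H => by_contra fun h0 => H _ h0 rfl⟩
    rw [this]
    exact (MeasurableSet.iUnion fun z => MeasurableSet.iUnion fun hz => key z hz).compl
  · exact key y hy

lemma measurable_edge_real (s h : ℤ) (n : ℕ) : Measurable fun ω => (edge ω s h n : ℝ) :=
  measurable_from_top.comp (measurable_edge s h n)

/-! ### The law of the oriented process -/

lemma measurable_shift (a b : ℤ) : Measurable (shift a b) :=
  measurable_pi_lambda _ fun _ => measurable_pi_apply _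

lemma siteLaw_map_shift (p : unitInterval) (a b : ℤ) :
    (siteLaw (ℤ × ℤ) p).map (shift a b) = siteLaw (ℤ × ℤ) p :=
  productLaw_map_injective (fun _ => p) (f := fun v : ℤ × ℤ => (v.1 + a, v.2 + b))
    fun v w hvw => by simpa [Prod.ext_iff] using hvw

/-- The event that the sites of height `-k` in the columns `s + 1, …, s + n` are open. -/
def openRow (s h : ℤ) (n k : ℕ) : Set (Config (ℤ × ℤ)) :=
  {ω | ∀ i < n, ω (s + i + 1, h - k) = true}

/-- A straight open row is itself a path. The depth of the first open row therefore bounds the edge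
from below, and it has a geometric tail because distinct rows are independent. -/
lemma mem_wet_of_openRow {ω : Config (ℤ × ℤ)} {s h : ℤ} {n k : ℕ} (hω : ω ∈ openRow s h n k) :
    h - k ∈ wet ω s h n :=
  mem_wet_iff.2 ⟨fun _ => h - k, by simp, rfl, fun i hi => ⟨by simp, hω i hi⟩⟩

lemma measurableSet_openRow (s h : ℤ) (n k : ℕ) : MeasurableSet (openRow s h n k) := by
  have : openRow s h n k = ⋂ i, ⋂ _ : i < n, {ω | ω (s + i + 1, h - k) = true} := by
    ext; simp [openRow]
  rw [this]
  exact MeasurableSet.iInter fun i => MeasurableSet.iInter fun _ =>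
    measurableSet_isOpen _

lemma siteLaw_openRow (p : unitInterval) (s h : ℤ) (n k : ℕ) :
    siteLaw (ℤ × ℤ) p (openRow s h n k) = ENNReal.ofReal p ^ n := by
  classical
  have := siteLaw_cylinder p (V := ℤ × ℤ) ∅
    ((Finset.range n).image fun i : ℕ => ((s + i + 1, h - k) : ℤ × ℤ)) (by simp)
  rw [Finset.card_image_of_injective _ fun i j hij => by simpa using hij] at this
  simpa [openRow] using this

lemma measurableSet_no_openRow (s h : ℤ) (n K : ℕ) :
    MeasurableSet {ω : Config (ℤ × ℤ) | ∀ k < K, ω ∉ openRow s h n k} := by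
  have : {ω : Config (ℤ × ℤ) | ∀ k < K, ω ∉ openRow s h n k} =
      ⋂ k, ⋂ _ : k < K, (openRow s h n k)ᶜ := by ext; simp
  rw [this]
  exact MeasurableSet.iInter fun k => MeasurableSet.iInter fun _ =>
    (measurableSet_openRow s h n k).compl

/-- The probability that none of the first `K` rows is open. -/
lemma siteLaw_no_openRow (p : unitInterval) (s h : ℤ) (n K : ℕ) :
    siteLaw (ℤ × ℤ) p {ω | ∀ k < K, ω ∉ openRow s h n k} = (1 - ENNReal.ofReal p ^ n) ^ K := by
  induction K with
  | zero => simp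
  | succ K ih =>
    have : {ω : Config (ℤ × ℤ) | ∀ k < K + 1, ω ∉ openRow s h n k} =
        {ω | ∀ k < K, ω ∉ openRow s h n k} ∩ (openRow s h n K)ᶜ := by
      ext ω
      simp only [Set.mem_ofPred_eq, Set.mem_inter_iff, Set.mem_compl_iff, Nat.lt_succ_iff_lt_or_eq]
      exact ⟨fun H => ⟨fun k hk => H k (Or.inl hk), H K (Or.inr rfl)⟩,
        fun H k hk => hk.elim (H.1 k) fun e => e ▸ H.2⟩
    rw [this, siteLaw_eq, measure_inter_of_dependsOn (fun _ => p) (measurableSet_no_openRow s h n K)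
      (measurableSet_openRow s h n K).compl (S := {v | h - K < v.2}) (T := {v | v.2 = h - K}),
      ← siteLaw_eq, ih, prob_compl_eq_one_sub (measurableSet_openRow s h n K), siteLaw_openRow,
      pow_succ]
    · intro x y hxy
      simp only [Set.mem_ofPred_eq, openRow, eq_iff_iff]
      refine forall₂_congr fun k hk => not_congr (forall₂_congr fun i hi => ?_)
      rw [hxy _ (by simpa using hk)]
    · intro x y hxy
      simp only [Set.mem_compl_iff, Set.mem_ofPred_eq, openRow, eq_iff_iff]
      refine not_congr (forall₂_congr fun i hi => ?_)
      rw [hxy _ (by simp)]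
    · rw [Set.disjoint_left]
      intro v h1 h2
      simp only [Set.mem_ofPred_eq] at h1 h2
      omega

lemma one_sub_pow_lt_one {p : unitInterval} (hp : 0 < (p : ℝ)) (n : ℕ) :
    1 - ENNReal.ofReal p ^ n < 1 :=
  ENNReal.sub_lt_self (by simp) (by simp) (pow_ne_zero _ (by simpa using hp))

lemma ae_exists_openRow (p : unitInterval) (hp : 0 < (p : ℝ)) (s h : ℤ) (n : ℕ) :
    ∀ᵐ ω ∂siteLaw (ℤ × ℤ) p, ∃ k, ω ∈ openRow s h n k := by
  refine measure_mono_null (t := ⋂ K, {ω | ∀ k < K, ω ∉ openRow s h n k}) ?_ ?_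
  · intro ω hω
    simp only [Set.mem_iInter, Set.mem_ofPred_eq]
    exact fun K k _ hk => hω ⟨k, hk⟩
  · refine le_antisymm (ge_of_tendsto' (ENNReal.tendsto_pow_atTop_nhds_zero_of_lt_one
      (one_sub_pow_lt_one hp n)) fun K => ?_) zero_le
    rw [← siteLaw_no_openRow p s h n K]
    exact measure_mono (Set.iInter_subset _ K)

/-- Almost surely, the process started from a half-line never dies out. -/
lemma ae_wet_nonempty (p : unitInterval) (hp : 0 < (p : ℝ)) :
    ∀ᵐ ω ∂siteLaw (ℤ × ℤ) p, ∀ s h n, (wet ω s h n).Nonempty := by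
  simp_rw [ae_all_iff]
  intro s h n
  filter_upwards [ae_exists_openRow p hp s h n] with ω ⟨k, hk⟩
  exact ⟨_, mem_wet_of_openRow hk⟩

/-- Almost surely the edge lies between `h - k` and `h + n`, where `k` is the index of the first
open row. The index `k` is written as the sum over `K` of the indicators that the first `K` rows all
fail, which turns its mean into a geometric series. -/
lemma integrable_edge (p : unitInterval) (hp : 0 < (p : ℝ)) (s h : ℤ) (n : ℕ) :
    Integrable (fun ω => (edge ω s h n : ℝ)) (siteLaw (ℤ × ℤ) p) := by
  refine ⟨(measurable_edge_real s h n).aestronglyMeasurable, ?_⟩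
  have hbound : ∀ᵐ ω ∂siteLaw (ℤ × ℤ) p, ‖(edge ω s h n : ℝ)‖ₑ ≤
      ENNReal.ofReal (|(h : ℝ)| + n) +
        ∑' K : ℕ, {ω : Config (ℤ × ℤ) | ∀ k < K, ω ∉ openRow s h n k}.indicator 1 ω := by
    filter_upwards [ae_exists_openRow p hp s h n] with ω hω
    classical
    have h1 := mem_wet_of_openRow (Nat.find_spec hω)
    have h2 := le_edge h1
    have h3 := edge_le ⟨_, h1⟩
    have h4 : ‖(edge ω s h n : ℝ)‖ₑ ≤ ENNReal.ofReal (|(h : ℝ)| + n) + (Nat.find hω : ℕ) := by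
      rw [← ENNReal.ofReal_natCast, ← ENNReal.ofReal_add (by positivity) (by positivity),
        ← ofReal_norm, Real.norm_eq_abs]
      apply ENNReal.ofReal_le_ofReal
      have h2' : (h : ℝ) - Nat.find hω ≤ edge ω s h n := by exact_mod_cast h2
      have h3' : (edge ω s h n : ℝ) ≤ h + n := by exact_mod_cast h3
      have := abs_le.1 (le_refl |(h : ℝ)|)
      rw [abs_le]
      constructor <;> linarith [(Nat.find hω).cast_nonneg (α := ℝ), n.cast_nonneg (α := ℝ)]
    refine h4.trans (by
      gcongr
      calc ((Nat.find hω : ℕ) : ℝ≥0∞) = ∑ K ∈ Finset.range (Nat.find hω), 1 := by simp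
        _ = ∑ K ∈ Finset.range (Nat.find hω),
            {ω : Config (ℤ × ℤ) | ∀ k < K, ω ∉ openRow s h n k}.indicator 1 ω := by
          refine Finset.sum_congr rfl fun K hK => ?_
          rw [Set.indicator_of_mem, Pi.one_apply]
          exact fun k hk => Nat.find_min hω (hk.trans (Finset.mem_range.1 hK))
        _ ≤ _ := ENNReal.sum_le_tsum _)
  refine lt_of_le_of_lt (lintegral_mono_ae hbound) ?_
  rw [lintegral_add_left measurable_const, lintegral_const, measure_univ, mul_one,
    lintegral_tsum (f := fun K ω =>
      {ω : Config (ℤ × ℤ) | ∀ k < K, ω ∉ openRow s h n k}.indicator 1 ω)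
      fun K => (measurable_one.indicator (measurableSet_no_openRow s h n K)).aemeasurable]
  refine ENNReal.add_lt_top.2 ⟨ENNReal.ofReal_lt_top, ?_⟩
  simp_rw [lintegral_indicator_one (measurableSet_no_openRow s h n _), siteLaw_no_openRow]
  rw [ENNReal.tsum_geometric, ENNReal.inv_lt_top]
  exact tsub_pos_of_lt (one_sub_pow_lt_one hp n)

/-- The law of the edge is invariant under translations. -/
lemma map_edge_sub (p : unitInterval) (hp : 0 < (p : ℝ)) (s h : ℤ) (n : ℕ) :
    (siteLaw (ℤ × ℤ) p).map (fun ω => edge ω s h n - h) =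
      (siteLaw (ℤ × ℤ) p).map fun ω => edge ω 0 0 n := by
  have h1 : (fun ω => edge ω s h n - h) =ᵐ[siteLaw (ℤ × ℤ) p]
      (fun ω => edge ω 0 0 n) ∘ shift s h := by
    filter_upwards [ae_wet_nonempty p hp] with ω hω
    simp only [Function.comp]
    rw [edge_shift s h (by simpa using hω _ _ _)]
    simp
  rw [Measure.map_congr h1, ← Measure.map_map (measurable_edge 0 0 n) (measurable_shift s h),
    siteLaw_map_shift]

/-- The expected displacement of the edge in `n` steps. -/
def meanEdge (p : unitInterval) (n : ℕ) : ℝ := ∫ ω, (edge ω 0 0 n : ℝ) ∂siteLaw (ℤ × ℤ) p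

lemma integral_edge (p : unitInterval) (hp : 0 < (p : ℝ)) (s h : ℤ) (n : ℕ) :
    ∫ ω, (edge ω s h n : ℝ) ∂siteLaw (ℤ × ℤ) p = h + meanEdge p n := by
  have h1 : ∫ ω, ((edge ω s h n - h : ℤ) : ℝ) ∂siteLaw (ℤ × ℤ) p = meanEdge p n := by
    have := integral_map (μ := siteLaw (ℤ × ℤ) p) (φ := fun ω => edge ω s h n - h)
      ((measurable_edge s h n).sub_const h).aemeasurable (f := fun k : ℤ => (k : ℝ))
      measurable_from_top.aestronglyMeasurable
    rw [← this, map_edge_sub p hp, integral_map (measurable_edge 0 0 n).aemeasurable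
      measurable_from_top.aestronglyMeasurable]
    rfl
  push_cast at h1
  rw [integral_sub (integrable_edge p hp s h n) (integrable_const _)] at h1
  simp only [integral_const, probReal_univ, one_smul] at h1
  linarith

open Filter Topology

/-! ### Large deviations of the edge -/

lemma disjoint_columns {a b c d : ℤ} (h : b ≤ c) : Disjoint (columns a b) (columns c d) :=
  Set.disjoint_left.2 fun _ h1 h2 => absurd (h2.1.trans_le (h1.2.trans h)) (lt_irrefl _)

lemma lintegral_edge_comp (p : unitInterval) (hp : 0 < (p : ℝ)) (s h : ℤ) (n : ℕ)
    (f : ℤ → ℝ≥0∞) :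
    ∫⁻ ω, f (edge ω s h n) ∂siteLaw (ℤ × ℤ) p =
      ∫⁻ ω, f (h + edge ω 0 0 n) ∂siteLaw (ℤ × ℤ) p := by
  have h1 := lintegral_map (μ := siteLaw (ℤ × ℤ) p) (f := fun k => f (h + k))
    measurable_from_top ((measurable_edge s h n).sub_const h)
  have h2 := lintegral_map (μ := siteLaw (ℤ × ℤ) p) (f := fun k => f (h + k))
    measurable_from_top (measurable_edge 0 0 n)
  rw [map_edge_sub p hp, h2] at h1
  rw [h1]
  simp

/-- An exponential moment of the displacement of the edge. -/
lemma exists_exp_moment_lt_one (p : unitInterval) (hp : 0 < (p : ℝ)) (m : ℕ) {c : ℝ}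
    (hc : meanEdge p m < c) : ∃ t > 0,
      ∫⁻ ω, ENNReal.ofReal (Real.exp (t * (edge ω 0 0 m - c))) ∂siteLaw (ℤ × ℤ) p < 1 := by
  have hi := integrable_edge p hp 0 0 m
  -- The edge is unbounded below. Truncating at `-K` makes it bounded, and by dominated convergence
  -- the mean stays below `c` for some `K`.
  have hlim : Tendsto (fun K : ℕ => ∫ ω, max (edge ω 0 0 m : ℝ) (-K) ∂siteLaw (ℤ × ℤ) p) atTop
      (𝓝 (meanEdge p m)) := by
    refine tendsto_integral_of_dominated_convergence (fun ω => |(edge ω 0 0 m : ℝ)|)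
      (fun K => ((measurable_edge_real 0 0 m).max measurable_const).aestronglyMeasurable)
      hi.abs (fun K => ?_) ?_
    · refine Eventually.of_forall fun ω => ?_
      rw [Real.norm_eq_abs, abs_le]
      have hK : (0 : ℝ) ≤ K := K.cast_nonneg
      exact ⟨(neg_abs_le _).trans (le_max_left _ _),
        max_le (le_abs_self _) ((neg_nonpos.2 hK).trans (abs_nonneg _))⟩
    · refine Eventually.of_forall fun ω => ?_
      obtain ⟨K, hK⟩ := exists_nat_gt (-(edge ω 0 0 m : ℝ))
      refine tendsto_const_nhds.congr' ?_
      filter_upwards [eventually_ge_atTop K] with L hL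
      have : (K : ℝ) ≤ L := by exact_mod_cast hL
      rw [max_eq_left (by linarith)]
  obtain ⟨K, hK⟩ := (hlim.eventually (gt_mem_nhds hc)).exists
  set X : Config (ℤ × ℤ) → ℝ := fun ω => max (edge ω 0 0 m : ℝ) (-K) with hX
  set e : ℝ := ∫ ω, X ω ∂siteLaw (ℤ × ℤ) p with he
  have hXm : Measurable X := (measurable_edge_real 0 0 m).max measurable_const
  -- Hoeffding's lemma for the truncated edge, with values in `[-K, m]`.
  have hsub := hasSubgaussianMGF_of_mem_Icc (μ := siteLaw (ℤ × ℤ) p) (X := X) (a := -K) (b := m)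
    hXm.aemeasurable (by
      filter_upwards [ae_wet_nonempty p hp] with ω hω
      have h1 : (edge ω 0 0 m : ℝ) ≤ m := by
        have := edge_le (hω 0 0 m)
        rw [zero_add] at this
        exact_mod_cast this
      have hK : (0 : ℝ) ≤ K := K.cast_nonneg
      have hm : (0 : ℝ) ≤ m := m.cast_nonneg
      exact ⟨le_max_right _ _, max_le h1 (by linarith)⟩)
  set v : NNReal := (‖(m : ℝ) - -K‖₊ / 2) ^ 2
  -- With this `t` the exponent `t (e - c) + v t² / 2` equals `-t² (v / 2 + 1)`. The summand 1 in
  -- the denominator covers `v = 0`.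
  set t : ℝ := (c - e) / (v + 1) with ht
  have hv : (0 : ℝ) < v + 1 := by positivity
  have htpos : 0 < t := div_pos (by linarith) hv
  refine ⟨t, htpos, ?_⟩
  have h1 : ∀ ω, ENNReal.ofReal (Real.exp (t * (edge ω 0 0 m - c))) ≤
      ENNReal.ofReal (Real.exp (t * (e - c))) * ENNReal.ofReal (Real.exp (t * (X ω - e))) := by
    intro ω
    rw [← ENNReal.ofReal_mul (Real.exp_nonneg _), ← Real.exp_add]
    refine ENNReal.ofReal_le_ofReal (Real.exp_le_exp.2 ?_)
    have : (edge ω 0 0 m : ℝ) ≤ X ω := le_max_left _ _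
    nlinarith
  refine (lintegral_mono h1).trans_lt ?_
  rw [lintegral_const_mul _ (by fun_prop), ← ofReal_integral_eq_lintegral_ofReal
    (hsub.integrable_exp_mul t) (Eventually.of_forall fun ω => Real.exp_nonneg _),
    ← ENNReal.ofReal_mul (Real.exp_nonneg _), ← ENNReal.ofReal_one,
    ENNReal.ofReal_lt_ofReal_iff one_pos]
  have h2 : ∫ ω, Real.exp (t * (X ω - e)) ∂siteLaw (ℤ × ℤ) p ≤ Real.exp (v * t ^ 2 / 2) :=
    hsub.mgf_le t
  calc _ ≤ Real.exp (t * (e - c)) * Real.exp (v * t ^ 2 / 2) := by gcongr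
    _ = Real.exp (t * (e - c) + v * t ^ 2 / 2) := by rw [Real.exp_add]
    _ < 1 := by
      rw [Real.exp_lt_one_iff]
      have h3 : c - e = t * (v + 1) := by rw [ht]; field_simp
      have : (0 : ℝ) ≤ v := v.2
      have : t * (e - c) + v * t ^ 2 / 2 = - t ^ 2 * (v / 2 + 1) := by
        rw [show e - c = -(t * (v + 1)) by linarith]; ring
      rw [this]
      have : 0 < t ^ 2 * ((v : ℝ) / 2 + 1) := by positivity
      linarith

/-- The edge exceeds any speed larger than an average speed with exponentially small
probability. -/
theorem edge_large_deviation (p : unitInterval) (hp : 0 < (p : ℝ)) (m : ℕ) {c : ℝ}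
    (hc : meanEdge p m < c) : ∃ θ < (1 : ℝ≥0∞), ∀ k : ℕ,
      siteLaw (ℤ × ℤ) p {ω | c * k ≤ edge ω 0 0 (m * k)} ≤ θ ^ k := by
  obtain ⟨t, ht, hlt⟩ := exists_exp_moment_lt_one p hp m hc
  set θ := ∫⁻ ω, ENNReal.ofReal (Real.exp (t * (edge ω 0 0 m - c))) ∂siteLaw (ℤ × ℤ) p
  refine ⟨θ, hlt, ?_⟩
  -- Given the edge after `m * k` columns, the next `m` columns are independent of it and contribute
  -- a factor of at most `θ`. Markov's inequality concludes.
  have hmoment : ∀ k : ℕ, ∫⁻ ω, ENNReal.ofReal (Real.exp (t * (edge ω 0 0 (m * k) - c * k)))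
      ∂siteLaw (ℤ × ℤ) p ≤ θ ^ k := by
    intro k
    induction k with
    | zero => simp
    | succ k ih =>
      set G : ℤ → ℝ≥0∞ := fun h => ENNReal.ofReal (Real.exp (t * (h - c * k))) with hG
      set Y : ℤ → Config (ℤ × ℤ) → ℝ≥0∞ := fun h ω =>
        ENNReal.ofReal (Real.exp (t * (edge ω ((m * k : ℕ) : ℤ) h m - c * (k + 1 : ℕ)))) with hY
      have hYm : ∀ h, Measurable (Y h) := fun h =>
        (Measurable.exp (((measurable_edge_real _ h m).sub_const _).const_mul t)).ennreal_ofReal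
      have h1 : ∫⁻ ω, ENNReal.ofReal (Real.exp (t * (edge ω 0 0 (m * (k + 1)) - c * (k + 1 : ℕ))))
          ∂siteLaw (ℤ × ℤ) p ≤ ∫⁻ ω, Y (edge ω 0 0 (m * k)) ω ∂siteLaw (ℤ × ℤ) p := by
        refine lintegral_mono_ae ?_
        filter_upwards [ae_wet_nonempty p hp] with ω hω
        refine ENNReal.ofReal_le_ofReal (Real.exp_le_exp.2 ?_)
        have := edge_add_le (m := m * k) (n := m) (hω 0 0 (m * k + m))
        rw [zero_add] at this
        have : (edge ω 0 0 (m * k + m) : ℝ) ≤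
          edge ω ((m * k : ℕ) : ℤ) (edge ω 0 0 (m * k)) m := by exact_mod_cast this
        rw [mul_add, mul_one]
        gcongr
      have h2 : ∀ h, ∫⁻ ω, Y h ω ∂siteLaw (ℤ × ℤ) p = G h * θ := by
        intro h
        rw [lintegral_edge_comp p hp _ h m
          (fun y => ENNReal.ofReal (Real.exp (t * (y - c * (k + 1 : ℕ))))),
          ← lintegral_const_mul _
            (Measurable.exp (((measurable_edge_real 0 0 m).sub_const _).const_mul t)).ennreal_ofReal]
        refine lintegral_congr fun ω => ?_
        rw [hG, ← ENNReal.ofReal_mul (Real.exp_nonneg _), ← Real.exp_add]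
        congr 2
        push_cast
        ring
      have hdep := dependsOn_edge 0 0 (m * k)
      have h3 := lintegral_randomIndex (fun _ => p) (measurable_edge 0 0 (m * k)) hYm hdep
        (T := columns ((m * k : ℕ) : ℤ) ((m * k : ℕ) + m : ℤ))
        (fun h x y hxy => by simp only [hY, edge_congr hxy]) (disjoint_columns (by simp))
      -- The decomposition over heights applied to a deterministic integrand, used backwards to
      -- reassemble the sum into the moment at stage `k`.
      have h4 := lintegral_randomIndex (fun _ => p) (Y := fun h _ => G h)
        (measurable_edge 0 0 (m * k)) (fun h => measurable_const) hdep
        (T := ∅) (fun h => dependsOn_const _) (by simp)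
      rw [← siteLaw_eq] at h3 h4
      refine h1.trans ?_
      rw [h3, pow_succ]
      simp_rw [h2, ← mul_assoc]
      rw [ENNReal.tsum_mul_right]
      gcongr
      refine le_trans (le_of_eq ?_) ih
      rw [← hG] at *
      simp only [lintegral_const, measure_univ, mul_one] at h4
      rw [← h4]
  intro k
  refine le_trans ?_ (hmoment k)
  have hmeas : Measurable fun ω =>
      ENNReal.ofReal (Real.exp (t * (edge ω 0 0 (m * k) - c * k))) :=
    (Measurable.exp (((measurable_edge_real 0 0 (m * k)).sub_const _).const_mul t)).ennreal_ofReal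
  have := mul_meas_ge_le_lintegral (μ := siteLaw (ℤ × ℤ) p) hmeas 1
  rw [one_mul] at this
  refine le_trans (measure_mono fun ω hω => ?_) this
  simp only [Set.mem_ofPred_eq] at hω ⊢
  rw [ENNReal.one_le_ofReal]
  exact Real.one_le_exp (mul_nonneg ht.le (by linarith))

/-! ### Survival -/

/-- The configuration reflected in the horizontal axis. -/
def flip (ω : Config (ℤ × ℤ)) : Config (ℤ × ℤ) := fun v => ω (v.1, -v.2)

lemma measurable_flip : Measurable flip := measurable_pi_lambda _ fun _ => measurable_pi_apply _

lemma siteLaw_map_flip (p : unitInterval) :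
    (siteLaw (ℤ × ℤ) p).map flip = siteLaw (ℤ × ℤ) p :=
  productLaw_map_injective (fun _ => p) (f := fun v : ℤ × ℤ => (v.1, -v.2))
    fun v w hvw => by simpa [Prod.ext_iff] using hvw

lemma altLattice_adj_iff {u v : ℤ × ℤ} :
    altLattice.Adj u v ↔ v.1 = u.1 + 1 ∧ |v.2 - u.2| ≤ 1 := by
  simp only [altLattice, Set.mem_insert_iff, Set.mem_singleton_iff, Prod.ext_iff, Prod.fst_sub,
    Prod.snd_sub, abs_le]
  omega

/-- If the edge moves down on average, then there is no percolation. -/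
theorem siteLaw_infinitePathEvent_eq_zero (p : unitInterval) (hp : 0 < (p : ℝ)) {m : ℕ}
    (hm : meanEdge p m < 0) :
    siteLaw (ℤ × ℤ) p (infinitePathEvent altLattice (0, 0)) = 0 := by
  obtain ⟨θ, hθ, hk⟩ := edge_large_deviation p hp m hm
  -- In column `m * k` the path has nonnegative or nonpositive height. In the first case the edge is
  -- nonnegative, in the second the edge of the reflected configuration is.
  have hsub : ∀ k : ℕ, infinitePathEvent altLattice (0, 0) ⊆
      {ω | (0 : ℝ) * k ≤ edge ω 0 0 (m * k)} ∪
        flip ⁻¹' {ω | (0 : ℝ) * k ≤ edge ω 0 0 (m * k)} := by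
    rintro k ω ⟨γ, -, hγ0, hγ, hopen⟩
    have hcol : ∀ n : ℕ, (γ n).1 = n := by
      intro n
      induction n with
      | zero => simp [hγ0]
      | succ n ih => rw [(altLattice_adj_iff.1 (hγ n)).1, ih]; simp
    have hw : ∀ n : ℕ, (γ n).2 ∈ wet ω 0 0 n := fun n => mem_wet_iff.2
      ⟨fun i => (γ i).2, by simp [hγ0], rfl, fun i _ => ⟨(altLattice_adj_iff.1 (hγ i)).2, by
        rw [← hopen (i + 1)]
        congr 1
        ext
        · simp [hcol]
        · rfl⟩⟩
    have hw' : ∀ n : ℕ, -(γ n).2 ∈ wet (flip ω) 0 0 n := fun n => mem_wet_iff.2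
      ⟨fun i => -(γ i).2, by simp [hγ0], rfl, fun i _ => ⟨by
        have := (altLattice_adj_iff.1 (hγ i)).2
        rw [← abs_neg] at this
        simpa [sub_eq_add_neg, add_comm] using this, by
        rw [← hopen (i + 1), flip]
        congr 1
        ext
        · simp [hcol]
        · simp⟩⟩
    simp only [zero_mul, Int.cast_nonneg_iff, Set.mem_union, Set.mem_ofPred_eq, Set.mem_preimage]
    rcases le_total 0 (γ (m * k)).2 with h | h
    · exact Or.inl (h.trans (le_edge (hw _)))
    · exact Or.inr ((neg_nonneg.2 h).trans (le_edge (hw' _)))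
  have hbound : ∀ k : ℕ, siteLaw (ℤ × ℤ) p (infinitePathEvent altLattice (0, 0)) ≤
      θ ^ k + θ ^ k := by
    intro k
    refine (measure_mono (hsub k)).trans ((measure_union_le _ _).trans (add_le_add (hk k) ?_))
    refine (Measure.le_map_apply measurable_flip.aemeasurable _).trans ?_
    rw [siteLaw_map_flip]
    exact hk k
  have h1 := ENNReal.tendsto_pow_atTop_nhds_zero_of_lt_one hθ
  have h2 := h1.add h1
  rw [add_zero] at h2
  exact le_antisymm (ge_of_tendsto' h2 hbound) zero_le

/-! ### Sprinkling -/

section Deterministic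

variable {ω ω' : Config (ℤ × ℤ)} {a : ℕ} {r : ℤ}

/-- A site reached from the higher half-line but not from the lower one is reached from the extra
site `(a, r + 1)`. That site is wet for `ω'`, and the configurations agree to its right. -/
lemma wet_succ_height_subset (hω : ∀ v : ℤ × ℤ, (a : ℤ) < v.1 → ω v = ω' v)
    (hr : r + 1 ∈ wet ω' 0 0 a) (j : ℕ) :
    wet ω a (r + 1) j ⊆ wet ω a r j ∪ wet ω' 0 0 (a + j) := by
  induction j with
  | zero =>
    intro y hy
    rcases (show y ≤ r + 1 from hy).lt_or_eq with h | rfl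
    · exact Or.inl (Int.lt_add_one_iff.1 h)
    · exact Or.inr hr
  | succ j ih =>
    rintro y ⟨hy, z, hz, hyz⟩
    rcases ih hz with h | h
    · exact Or.inl ⟨hy, z, h, hyz⟩
    · refine Or.inr ⟨?_, z, h, hyz⟩
      rw [← hy, hω _ (by simp only; linarith [Int.natCast_nonneg j])]
      congr 2
      have : ((a.add j : ℕ) : ℤ) = a + j := Int.natCast_add a j
      rw [this]
      ring

/-- The gain of the edge by the addition of a site just above it is at least as large as for the
processes started from half-lines. -/
lemma edge_gain (hle : ∀ v, ω v = true → ω' v = true)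
    (hω : ∀ v : ℤ × ℤ, (a : ℤ) < v.1 → ω v = ω' v) (hne : ∀ s h n, (wet ω s h n).Nonempty)
    (hr : edge ω 0 0 a ≤ r) (hr' : r + 1 ∈ wet ω' 0 0 a) (j : ℕ) :
    edge ω a (r + 1) j - edge ω a r j ≤ edge ω' 0 0 (a + j) - edge ω 0 0 (a + j) := by
  have h1 : edge ω 0 0 (a + j) ≤ edge ω a r j := by
    have := edge_add_le (m := a) (n := j) (hne 0 0 (a + j))
    rw [zero_add] at this
    exact this.trans (edge_mono_height hr (hne _ _ _))
  have h2 := edge_mono_config hle (hne 0 0 (a + j))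
  -- If the top site is also reached from height `r`, the left side is nonpositive and the right
  -- side nonnegative. Otherwise it lies below the edge of `ω'`, while the edge of `ω` lies below
  -- the process restarted from `r`.
  rcases wet_succ_height_subset hω hr' j (edge_mem (hne a (r + 1) j)) with h | h
  · have := le_edge h
    linarith
  · have := le_edge h
    linarith

end Deterministic

/-! ### Superposition of two independent configurations -/

/-- The first of two superposed configurations. -/
def baseConfig (ω : Config ((ℤ × ℤ) × Bool)) : Config (ℤ × ℤ) := fun v => ω (v, false)

/-- The first of two superposed configurations, together with the open sites of the second one in
the columns up to `k`. -/
def sprinkled (k : ℤ) (ω : Config ((ℤ × ℤ) × Bool)) : Config (ℤ × ℤ) :=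
  fun v => ω (v, false) || (decide (v.1 ≤ k) && ω (v, true))

lemma measurable_baseConfig : Measurable baseConfig :=
  measurable_pi_lambda _ fun _ => measurable_pi_apply _

lemma measurable_sprinkled (k : ℤ) : Measurable (sprinkled k) :=
  measurable_pi_lambda _ fun v =>
    Measurable.comp (g := fun x : Bool × Bool => x.1 || (decide (v.1 ≤ k) && x.2))
      (f := fun ω : Config ((ℤ × ℤ) × Bool) => (ω (v, false), ω (v, true)))
      (measurable_of_finite _)
      ((measurable_pi_apply (v, false)).prodMk (measurable_pi_apply (v, true)))

lemma baseConfig_le_sprinkled (k : ℤ) (ω : Config ((ℤ × ℤ) × Bool)) (v : ℤ × ℤ)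
    (h : baseConfig ω v = true) : sprinkled k ω v = true := by
  simp only [baseConfig] at h
  simp [sprinkled, h]

/-- The law of two superposed configurations of parameters `p` and `s`. -/
abbrev superposedLaw (p s : unitInterval) : Measure (Config ((ℤ × ℤ) × Bool)) :=
  productLaw fun v => if v.2 then s else p

section Superposed

variable (p s : unitInterval)

lemma superposedLaw_map_baseConfig :
    (superposedLaw p s).map baseConfig = siteLaw (ℤ × ℤ) p := by
  have := productLaw_map_injective (fun v : (ℤ × ℤ) × Bool => if v.2 then s else p)
    (f := fun v : ℤ × ℤ => (v, false)) fun v w hvw => by simpa using hvw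
  simp only [Bool.false_eq_true, if_false] at this
  exact this

variable {p}

lemma ae_superposed_nonempty (hp : 0 < (p : ℝ)) :
    ∀ᵐ ω ∂superposedLaw p s, ∀ s h n, (wet (baseConfig ω) s h n).Nonempty := by
  have h1 := ae_wet_nonempty p hp
  rw [← superposedLaw_map_baseConfig p s] at h1
  exact ae_of_ae_map measurable_baseConfig.aemeasurable h1

lemma integrable_edge_baseConfig (hp : 0 < (p : ℝ)) (c h : ℤ) (n : ℕ) :
    Integrable (fun ω => (edge (baseConfig ω) c h n : ℝ)) (superposedLaw p s) := by
  have h1 := integrable_edge p hp c h n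
  rw [← superposedLaw_map_baseConfig p s] at h1
  exact h1.comp_measurable measurable_baseConfig

lemma integral_edge_baseConfig (hp : 0 < (p : ℝ)) (c h : ℤ) (n : ℕ) :
    ∫ ω, (edge (baseConfig ω) c h n : ℝ) ∂superposedLaw p s = h + meanEdge p n := by
  rw [← integral_edge p hp c h n, ← superposedLaw_map_baseConfig p s,
    integral_map measurable_baseConfig.aemeasurable
      (measurable_edge_real c h n).aestronglyMeasurable]

lemma integrable_edge_sprinkled (hp : 0 < (p : ℝ)) (k : ℤ) (n : ℕ) :
    Integrable (fun ω => (edge (sprinkled k ω) 0 0 n : ℝ)) (superposedLaw p s) := by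
  refine Integrable.mono' ((integrable_edge_baseConfig s hp 0 0 n).abs.add (integrable_const (n : ℝ)))
    ((measurable_edge_real 0 0 n).comp (measurable_sprinkled k)).aestronglyMeasurable ?_
  filter_upwards [ae_superposed_nonempty s hp] with ω hω
  have h1 := edge_mono_config (baseConfig_le_sprinkled k ω) (hω 0 0 n)
  have h2 := edge_le ((hω 0 0 n).mono (wet_mono_config (baseConfig_le_sprinkled k ω)))
  rw [zero_add] at h2
  have h1' : (edge (baseConfig ω) 0 0 n : ℝ) ≤ edge (sprinkled k ω) 0 0 n := by exact_mod_cast h1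
  have h2' : (edge (sprinkled k ω) 0 0 n : ℝ) ≤ n := by exact_mod_cast h2
  rw [Real.norm_eq_abs, abs_le, Pi.add_apply]
  have h3 := neg_abs_le (edge (baseConfig ω) 0 0 n : ℝ)
  have h4 := abs_nonneg (edge (baseConfig ω) 0 0 n : ℝ)
  have h5 : (0 : ℝ) ≤ n := n.cast_nonneg
  constructor <;> linarith

/-- The event that the site `v` is closed in the first and open in the second configuration. -/
def newlyOpen (v : ℤ × ℤ) : Set (Config ((ℤ × ℤ) × Bool)) :=
  {ω | ω (v, false) = false ∧ ω (v, true) = true}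

lemma measurableSet_newlyOpen (v : ℤ × ℤ) : MeasurableSet (newlyOpen v) :=
  (measurableSet_eq_fun (measurable_pi_apply _) measurable_const).inter (measurableSet_isOpen _)

variable (p) in
lemma superposedLaw_newlyOpen (v : ℤ × ℤ) :
    superposedLaw p s (newlyOpen v) = ENNReal.ofReal ((1 - p) * s) := by
  have := productLaw_cylinder (fun v : (ℤ × ℤ) × Bool => if v.2 then s else p)
    {(v, false)} {(v, true)} (by simp)
  simp only [Finset.mem_singleton, forall_eq, Finset.prod_singleton, Bool.false_eq_true, if_false,
    if_true] at this
  rw [ENNReal.ofReal_mul (by linarith [p.2.2]), ← this]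
  rfl

/-- Let `r` be the edge in column `k`. Before column `k + 1` is sprinkled, its site at height `r +
1` is closed, so the edge there is at most `r`. Afterwards this site is wet, and `edge_gain`
applies. -/
lemma edge_gain_sprinkled {ω : Config ((ℤ × ℤ) × Bool)} {k j : ℕ}
    (hne : ∀ s h n, (wet (baseConfig ω) s h n).Nonempty)
    (hnew : ω ∈ newlyOpen ((k + 1 : ℕ), edge (sprinkled k ω) 0 0 k + 1)) :
    edge (baseConfig ω) (k + 1 : ℕ) (edge (sprinkled k ω) 0 0 k + 1) j -
        edge (baseConfig ω) (k + 1 : ℕ) (edge (sprinkled k ω) 0 0 k) j ≤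
      edge (sprinkled (k + 1 : ℕ) ω) 0 0 (k + 1 + j) - edge (sprinkled k ω) 0 0 (k + 1 + j) := by
  set r := edge (sprinkled k ω) 0 0 k with hr
  have hne' : ∀ s h n, (wet (sprinkled k ω) s h n).Nonempty := fun s h n =>
    (hne s h n).mono (wet_mono_config (baseConfig_le_sprinkled k ω))
  have hle : ∀ v, sprinkled k ω v = true → sprinkled (k + 1 : ℕ) ω v = true := by
    intro v hv
    simp only [sprinkled, Bool.or_eq_true, Bool.and_eq_true, decide_eq_true_eq] at hv ⊢
    exact hv.imp_right fun h => ⟨h.1.trans (by simp), h.2⟩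
  have hbase : ∀ (h : ℤ) (j : ℕ), edge (baseConfig ω) (k + 1 : ℕ) h j =
      edge (sprinkled k ω) (k + 1 : ℕ) h j := by
    intro h j
    refine edge_congr fun v hv => ?_
    have : ¬ v.1 ≤ k := by have := hv.1; push_cast at this; linarith
    simp [baseConfig, sprinkled, this]
  rw [hbase, hbase]
  refine edge_gain hle (fun v hv => ?_) hne' ?_ ?_ j
  · have h1 : ¬ v.1 ≤ k := by push_cast at hv; linarith
    have h2 : ¬ v.1 ≤ (k + 1 : ℕ) := by linarith
    simp only [sprinkled, h1, h2]
  · have hmem := edge_mem (hne' 0 0 (k + 1))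
    obtain ⟨hopen, z, hz, hyz⟩ := hmem
    have hz' := le_edge hz
    rw [abs_le] at hyz
    by_contra hlt
    have : edge (sprinkled k ω) 0 0 (k + 1) = r + 1 := by linarith
    rw [this] at hopen
    have h1 : ω (((k + 1 : ℕ), r + 1), false) = false := hnew.1
    push_cast at h1
    simp [sprinkled, h1] at hopen
  · refine ⟨?_, r, ?_, by simp⟩
    · have h1 : ω (((k + 1 : ℕ), r + 1), true) = true := hnew.2
      push_cast at h1
      simp [sprinkled, h1]
    · exact wet_mono_config hle (edge_mem (hne' 0 0 k))

/-- By translation invariance, raising the half-line by one raises the mean edge by exactly one. The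
difference is nonnegative, so the truncation by `ENNReal.ofReal` is harmless. -/
lemma lintegral_edge_sub (hp : 0 < (p : ℝ)) (c h : ℤ) (j : ℕ) :
    ∫⁻ ω, ENNReal.ofReal (edge (baseConfig ω) c (h + 1) j - edge (baseConfig ω) c h j)
      ∂superposedLaw p s = 1 := by
  rw [← ofReal_integral_eq_lintegral_ofReal (f := fun ω =>
      (edge (baseConfig ω) c (h + 1) j - edge (baseConfig ω) c h j : ℝ))
    ((integrable_edge_baseConfig s hp _ _ _).sub (integrable_edge_baseConfig s hp _ _ _)),
    integral_sub (integrable_edge_baseConfig s hp _ _ _) (integrable_edge_baseConfig s hp _ _ _),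
    integral_edge_baseConfig s hp, integral_edge_baseConfig s hp]
  · simp
  · filter_upwards [ae_superposed_nonempty s hp] with ω hω
    have := edge_mono_height (h := h) (h' := h + 1) (by simp) (hω c h j)
    simpa using this

/-- Three independent ingredients: columns up to `k` determine the edge, column `k + 1` decides with
probability `(1 - p) * s` that the site just above it is newly open, and the later columns determine
a gain of mean one. -/
lemma integral_edge_sprinkled_succ (hp : 0 < (p : ℝ)) (k j : ℕ) :
    (1 - p) * s + ∫ ω, (edge (sprinkled k ω) 0 0 (k + 1 + j) : ℝ) ∂superposedLaw p s ≤
      ∫ ω, (edge (sprinkled (k + 1 : ℕ) ω) 0 0 (k + 1 + j) : ℝ) ∂superposedLaw p s := by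
  have hi := fun k : ℤ => integrable_edge_sprinkled s hp k
  set D : ℤ → Config ((ℤ × ℤ) × Bool) → ℝ≥0∞ := fun h ω =>
    ENNReal.ofReal (edge (baseConfig ω) (k + 1 : ℕ) (h + 1) j - edge (baseConfig ω) (k + 1 : ℕ) h j)
    with hD
  have hDm : ∀ h, Measurable (D h) := fun h =>
    (((measurable_edge_real _ _ _).comp measurable_baseConfig).sub
      ((measurable_edge_real _ _ _).comp measurable_baseConfig)).ennreal_ofReal
  have hDdep : ∀ h, DependsOn (D h) {v | ((k + 1 : ℕ) : ℤ) < v.1.1} := by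
    intro h x y hxy
    simp only [hD]
    have : ∀ h', edge (baseConfig x) (k + 1 : ℕ) h' j = edge (baseConfig y) (k + 1 : ℕ) h' j :=
      fun h' => edge_congr fun v hv => hxy (v, false) hv.1
    rw [this, this]
  set Y : ℤ → Config ((ℤ × ℤ) × Bool) → ℝ≥0∞ := fun h ω =>
    (newlyOpen ((k + 1 : ℕ), h + 1)).indicator 1 ω * D h ω with hY
  have hindm : ∀ h : ℤ, Measurable ((newlyOpen ((k + 1 : ℕ), h + 1)).indicator
      (1 : Config ((ℤ × ℤ) × Bool) → ℝ≥0∞)) := fun h =>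
    measurable_one.indicator (measurableSet_newlyOpen _)
  have hinddep : ∀ h : ℤ, DependsOn ((newlyOpen ((k + 1 : ℕ), h + 1)).indicator
      (1 : Config ((ℤ × ℤ) × Bool) → ℝ≥0∞)) {v | v.1.1 = (k + 1 : ℕ)} := by
    intro h x y hxy
    have : x ∈ newlyOpen ((k + 1 : ℕ), h + 1) ↔ y ∈ newlyOpen ((k + 1 : ℕ), h + 1) := by
      simp only [newlyOpen, Set.mem_ofPred_eq]
      rw [hxy _ (by simp), hxy _ (by simp)]
    classical
    exact if_congr this rfl rfl
  have hYint : ∀ h, ∫⁻ ω, Y h ω ∂superposedLaw p s = ENNReal.ofReal ((1 - p) * s) := by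
    intro h
    simp only [hY]
    rw [lintegral_mul_of_dependsOn _ (hindm h) (hDm h) (hinddep h) (hDdep h),
      lintegral_indicator_one (measurableSet_newlyOpen _), superposedLaw_newlyOpen,
      lintegral_edge_sub s hp, mul_one]
    exact Set.disjoint_left.2 fun v h1 h2 => (ne_of_gt h2) h1
  have hX : Measurable fun ω => edge (sprinkled k ω) 0 0 k :=
    (measurable_edge 0 0 k).comp (measurable_sprinkled k)
  have hsum := lintegral_randomIndex (fun v : (ℤ × ℤ) × Bool => if v.2 then s else p)
    (X := fun ω => edge (sprinkled k ω) 0 0 k) (Y := Y) hX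
    (fun h => (hindm h).mul (hDm h)) (S := {v | v.1.1 ≤ k}) (T := {v | (k : ℤ) < v.1.1})
    (fun x y hxy => edge_congr fun v hv => by
      have : v.1 ≤ k := by simpa using hv.2
      simp only [sprinkled]
      rw [hxy (v, false) this, hxy (v, true) this])
    (fun h x y hxy => by
      simp only [hY]
      rw [hinddep h fun v hv => hxy v (by rw [Set.mem_ofPred_eq] at hv ⊢; rw [hv]; simp),
        hDdep h fun v hv => hxy v (by rw [Set.mem_ofPred_eq] at hv ⊢; push_cast at hv; linarith)])
    (Set.disjoint_left.2 fun v (h1 : v.1.1 ≤ k) (h2 : k < v.1.1) =>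
      absurd (h2.trans_le h1) (lt_irrefl _))
  simp_rw [hYint] at hsum
  rw [ENNReal.tsum_mul_right, tsum_measure_fiber _ hX, one_mul] at hsum
  have hgain : 0 ≤ᵐ[superposedLaw p s] fun ω => ((edge (sprinkled (k + 1 : ℕ) ω) 0 0 (k + 1 + j) : ℝ) -
      edge (sprinkled k ω) 0 0 (k + 1 + j)) := by
    filter_upwards [ae_superposed_nonempty s hp] with ω hω
    have hle : ∀ v, sprinkled k ω v = true → sprinkled (k + 1 : ℕ) ω v = true := by
      intro v hv
      simp only [sprinkled, Bool.or_eq_true, Bool.and_eq_true, decide_eq_true_eq] at hv ⊢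
      exact hv.imp_right fun h => ⟨h.1.trans (by simp), h.2⟩
    have := edge_mono_config (s := 0) (h := 0) (n := k + 1 + j) hle
      ((hω _ _ _).mono (wet_mono_config (baseConfig_le_sprinkled k ω)))
    simpa using this
  have hfinal : ENNReal.ofReal ((1 - p) * s) ≤ ENNReal.ofReal
      (∫ ω, ((edge (sprinkled (k + 1 : ℕ) ω) 0 0 (k + 1 + j) : ℝ) -
        edge (sprinkled k ω) 0 0 (k + 1 + j)) ∂superposedLaw p s) := by
    rw [← hsum, ofReal_integral_eq_lintegral_ofReal (f := fun ω =>
      ((edge (sprinkled (k + 1 : ℕ) ω) 0 0 (k + 1 + j) : ℝ) -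
        edge (sprinkled k ω) 0 0 (k + 1 + j))) ((hi _ _).sub (hi _ _)) hgain]
    refine lintegral_mono_ae ?_
    filter_upwards [ae_superposed_nonempty s hp] with ω hω
    simp only [hY]
    by_cases hnew : ω ∈ newlyOpen ((k + 1 : ℕ), edge (sprinkled k ω) 0 0 k + 1)
    · rw [Set.indicator_of_mem hnew, Pi.one_apply, one_mul]
      refine ENNReal.ofReal_le_ofReal ?_
      have := edge_gain_sprinkled (j := j) hω hnew
      exact_mod_cast this
    · rw [Set.indicator_of_notMem hnew, zero_mul]
      exact zero_le
  rw [ENNReal.ofReal_le_ofReal_iff (integral_nonneg_of_ae hgain),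
    integral_sub (hi _ _) (hi _ _)] at hfinal
  linarith

/-- The mean speed of the edge grows at least linearly with the density of the open sites. -/
theorem meanEdge_add_le {p' : unitInterval} (hp : 0 < (p : ℝ)) (hpp : p < p') (n : ℕ) :
    meanEdge p n + n * (p' - p : ℝ) ≤ meanEdge p' n := by
  have hpp' : (p : ℝ) < p' := hpp
  have hp1 : (p : ℝ) < 1 := hpp'.trans_le p'.2.2
  have h1p : (0 : ℝ) < 1 - p := by linarith
  -- Chosen so that the superposition has density `p'`. The gain `(1 - p) * s` per column is then
  -- `p' - p`.
  let s : unitInterval := ⟨((p' : ℝ) - p) / (1 - p), div_nonneg (by linarith) h1p.le,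
    (div_le_one h1p).2 (by linarith [p'.2.2])⟩
  have hs : (1 - p : ℝ) * s = p' - p := mul_div_cancel₀ _ h1p.ne'
  have hstep : ∀ k ≤ n, k * (p' - p : ℝ) + meanEdge p n ≤
      ∫ ω, (edge (sprinkled k ω) 0 0 n : ℝ) ∂superposedLaw p s := by
    intro k hk
    induction k with
    | zero =>
      have h0 : ∫ ω, (edge (sprinkled (0 : ℕ) ω) 0 0 n : ℝ) ∂superposedLaw p s =
          ∫ ω, (edge (baseConfig ω) 0 0 n : ℝ) ∂superposedLaw p s := by
        refine integral_congr_ae (Eventually.of_forall fun ω => ?_)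
        simp only
        rw [edge_congr fun v hv => ?_]
        have : ¬ v.1 ≤ 0 := not_le.2 hv.1
        simp [baseConfig, sprinkled, this]
      rw [h0, integral_edge_baseConfig s hp]
      simp
    | succ k ih =>
      obtain ⟨j, rfl⟩ := Nat.exists_eq_add_of_le hk
      have h1 := ih (by omega)
      have h2 := integral_edge_sprinkled_succ s hp k j
      rw [hs] at h2
      push_cast at h1 h2 ⊢
      linarith
  have hn := hstep n le_rfl
  have hmap := productLaw_map_or (V := ℤ × ℤ) p s p' (by rw [mul_sub, mul_one, hs]; ring)
  have hor : Measurable fun (ω : Config ((ℤ × ℤ) × Bool)) (v : ℤ × ℤ) =>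
      ω (v, false) || ω (v, true) :=
    measurable_pi_lambda _ fun v =>
      Measurable.comp (g := fun x : Bool × Bool => x.1 || x.2)
        (f := fun ω : Config ((ℤ × ℤ) × Bool) => (ω (v, false), ω (v, true)))
        (measurable_of_finite _)
        ((measurable_pi_apply (v, false)).prodMk (measurable_pi_apply (v, true)))
  have hlast : ∫ ω, (edge (sprinkled n ω) 0 0 n : ℝ) ∂superposedLaw p s = meanEdge p' n := by
    rw [meanEdge, ← hmap, integral_map hor.aemeasurable
      (measurable_edge_real 0 0 n).aestronglyMeasurable]
    refine integral_congr_ae (Eventually.of_forall fun ω => ?_)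
    simp only
    rw [edge_congr fun v hv => ?_]
    have : v.1 ≤ n := by simpa using hv.2
    simp [sprinkled, this]
  rw [hlast] at hn
  linarith

end Superposed

/-! ### Ladders -/

/-- The event that there is an open Lipschitz function, for site percolation on `ℤ × ℤ`. -/
def lipschitzEvent : Set (Config (ℤ × ℤ)) :=
  {ω | ∃ F : ℤ → ℤ, (∀ x, 0 < F x) ∧ (∀ x, |F (x + 1) - F x| ≤ 1) ∧ ∀ x, ω (x, F x) = true}

section Ladder

variable {ω : Config (ℤ × ℤ)}

/-- Every vertical half-line contains an open site. -/
def NoClosedRay (ω : Config (ℤ × ℤ)) : Prop := ∀ x y : ℤ, ∃ n : ℕ, ω (x, y + n + 1) = true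

/-- The height reached from `(x, y)` by climbing closed sites. -/
def climb (hω : NoClosedRay ω) (x y : ℤ) : ℤ := y + Nat.find (hω x y)

variable (hω : NoClosedRay ω)

lemma le_climb (x y : ℤ) : y ≤ climb hω x y := by simp [climb]

lemma climb_open (x y : ℤ) : ω (x, climb hω x y + 1) = true := Nat.find_spec (hω x y)

lemma climb_closed {x y z : ℤ} (h1 : y < z) (h2 : z ≤ climb hω x y) : ω (x, z) = false := by
  have hz : z = y + ((z - y - 1).toNat : ℤ) + 1 := by omega
  have := Nat.find_min (hω x y) (m := (z - y - 1).toNat) (by rw [climb] at h2; omega)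
  rw [← hz] at this
  simpa using this

lemma climb_le {x y z : ℤ} (hyz : y ≤ z) (hz : ω (x, z + 1) = true) : climb hω x y ≤ z := by
  by_contra hlt
  have := climb_closed hω (x := x) (y := y) (z := z + 1) (by linarith) (by linarith)
  rw [this] at hz
  exact Bool.false_ne_true hz

lemma climb_mono {x y y' : ℤ} (h : y ≤ y') : climb hω x y ≤ climb hω x y' :=
  climb_le hω (h.trans (le_climb hω x y')) (climb_open hω x y')

lemma climb_climb (x y : ℤ) : climb hω x (climb hω x y) = climb hω x y :=
  le_antisymm (climb_le hω le_rfl (climb_open hω x y)) (le_climb _ _ _)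

/-- The heights reached along a sequence of columns, where each move to the next column goes down
by `1`, and is followed by a climb. -/
def ladderTop (x : ℕ → ℤ) : ℕ → ℤ
  | 0 => climb hω (x 0) 0
  | i + 1 => climb hω (x (i + 1)) (ladderTop x i - 1)

lemma ladderTop_congr {x x' : ℕ → ℤ} {k : ℕ} (h : ∀ i ≤ k, x i = x' i) :
    ladderTop hω x k = ladderTop hω x' k := by
  induction k with
  | zero => simp [ladderTop, h 0 le_rfl]
  | succ k ih =>
    rw [ladderTop, ladderTop, h _ le_rfl, ih fun i hi => h i (hi.trans (Nat.le_succ k))]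

/-- Climbing is monotone in the starting height, so an advantage persists along a common
continuation. This allows loops to be cut out of ladders. -/
lemma ladderTop_shift_le {x x' : ℕ → ℤ} {a b : ℕ} (hx : ∀ i, x' (a + i) = x (b + i))
    (h : ladderTop hω x b ≤ ladderTop hω x' a) (i : ℕ) :
    ladderTop hω x (b + i) ≤ ladderTop hω x' (a + i) := by
  induction i with
  | zero => exact h
  | succ i ih =>
    rw [← add_assoc, ← add_assoc, ladderTop, ladderTop, add_assoc a, add_assoc b, hx]
    exact climb_mono hω (by linarith)

/-- A sequence of columns with steps between neighbouring columns. -/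
def IsWalk (x : ℕ → ℤ) (k : ℕ) : Prop := ∀ i < k, |x (i + 1) - x i| = 1

lemma IsWalk.snoc {x : ℕ → ℤ} {k : ℕ} (hx : IsWalk x k) {z : ℤ} (hz : |z - x k| = 1) :
    ∃ x' : ℕ → ℤ, IsWalk x' (k + 1) ∧ x' (k + 1) = z ∧
      ladderTop hω x' (k + 1) = climb hω z (ladderTop hω x k - 1) := by
  refine ⟨fun i => if i ≤ k then x i else z, fun i hi => ?_, by simp, ?_⟩
  · rcases (Nat.lt_succ_iff.1 hi).lt_or_eq with h | rfl
    · simpa [h.le, Nat.succ_le_of_lt h] using hx i h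
    · simpa using hz
  · rw [ladderTop, ladderTop_congr hω (x' := x) fun i hi => by simp [hi]]
    simp

/-- If the ladders are bounded at the origin, then their upper envelope gives an open Lipschitz
function. -/
lemma mem_lipschitzEvent_of_bounded {h : ℤ}
    (hb : ∀ k x, IsWalk x k → x k = 0 → ladderTop hω x k < h) : ω ∈ lipschitzEvent := by
  set R : ℤ → Set ℤ := fun z => {t | ∃ k x, IsWalk x k ∧ x k = z ∧ ladderTop hω x k = t} with hR
  have hmove : ∀ z z' t, |z' - z| = 1 → t ∈ R z → ∃ t' ∈ R z', t - 1 ≤ t' := by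
    rintro z z' t hz ⟨k, x, hx, rfl, rfl⟩
    obtain ⟨x', hx', hz', ht'⟩ := hx.snoc hω hz
    exact ⟨_, ⟨k + 1, x', hx', hz', ht'⟩, le_climb _ _ _⟩
  -- A ladder can be prolonged straight to the origin at the cost of one unit per column, so the
  -- bound at the origin spreads to every column.
  have hbdd : ∀ n : ℕ, ∀ z : ℤ, z.natAbs = n → ∀ t ∈ R z, t ≤ h + n := by
    intro n
    induction n with
    | zero =>
      rintro z hz t ⟨k, x, hx, hxz, rfl⟩
      have := hb k x hx (by omega)
      simpa using this.le
    | succ n ih =>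
      intro z hz t ht
      rcases le_total 0 z with hz0 | hz0
      · obtain ⟨t', ht', hle⟩ := hmove z (z - 1) t (by simp) ht
        have := ih _ (by omega) t' ht'
        push_cast
        linarith
      · obtain ⟨t', ht', hle⟩ := hmove z (z + 1) t (by simp) ht
        have := ih _ (by omega) t' ht'
        push_cast
        linarith
  have hbd : ∀ z, BddAbove (R z) := fun z => ⟨_, fun t ht => hbdd _ z rfl t ht⟩
  have hne : ∀ z, climb hω z 0 ∈ R z := fun z =>
    ⟨0, fun _ => z, fun i hi => absurd hi (Nat.not_lt_zero i), rfl, rfl⟩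
  have hmem : ∀ z, sSup (R z) ∈ R z := fun z => Int.csSup_mem ⟨_, hne z⟩ (hbd z)
  have hstep : ∀ z z', |z' - z| = 1 → sSup (R z) - 1 ≤ sSup (R z') := by
    intro z z' hz
    obtain ⟨t', ht', hle⟩ := hmove z z' _ hz (hmem z)
    exact hle.trans (le_csSup (hbd z') ht')
  -- The supremum is attained by a ladder, and a climb stops just below an open site. It is
  -- nonnegative because ladders may start in `z` at height 0; the added 1 makes the function
  -- positive.
  refine ⟨fun z => sSup (R z) + 1, fun z => ?_, fun z => ?_, fun z => ?_⟩
  · have := (le_climb hω z 0).trans (le_csSup (hbd z) (hne z))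
    linarith
  · have h1 := hstep z (z + 1) (by simp)
    have h2 := hstep (z + 1) z (by simp)
    rw [abs_le]
    constructor <;> linarith
  · obtain ⟨k, x, -, hxz, ht⟩ := hmem z
    simp only
    rw [← ht, ← hxz]
    cases k with
    | zero => exact climb_open hω _ _
    | succ k => exact climb_open hω _ _

/-- The height at which a ladder enters its columns. -/
def ladderEntry (x : ℕ → ℤ) : ℕ → ℤ
  | 0 => 0
  | i + 1 => ladderTop hω x i - 1

lemma ladderTop_eq (x : ℕ → ℤ) (i : ℕ) :
    ladderTop hω x i = climb hω (x i) (ladderEntry hω x i) := by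
  cases i <;> rfl

/-- A shortest ladder that reaches the height `h` at the origin enters each column above the heights
that it has seen before. -/
lemma exists_minimal_ladder {h : ℤ}
    (hex : ∃ k x, IsWalk x k ∧ x k = 0 ∧ h ≤ ladderTop hω x k) :
    ∃ k x, IsWalk x k ∧ x k = 0 ∧ h ≤ ladderTop hω x k ∧
      ∀ a b, a < b → b ≤ k → x a = x b → ladderTop hω x a < ladderEntry hω x b := by
  classical
  obtain ⟨x, hx, hx0, hxh⟩ := Nat.find_spec hex
  refine ⟨_, x, hx, hx0, hxh, fun a b hab hbk hxab => ?_⟩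
  set k := Nat.find hex with hk
  by_contra hle
  push Not at hle
  -- Entering a column at or below an earlier top cannot end higher than that top. Removing the
  -- steps between the two visits then gives a shorter ladder at least as high at the origin,
  -- against minimality.
  have hba : ladderTop hω x b ≤ ladderTop hω x a := by
    rw [ladderTop_eq hω x b, ← hxab]
    calc _ ≤ climb hω (x a) (ladderTop hω x a) := climb_mono hω hle
      _ = _ := by rw [ladderTop_eq hω x a, climb_climb]
  set x' : ℕ → ℤ := fun i => if i ≤ a then x i else x (i + (b - a)) with hx'
  have hx'a : ∀ i, x' (a + i) = x (b + i) := by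
    intro i
    rcases Nat.eq_zero_or_pos i with rfl | hi
    · simpa [hx'] using hxab
    · have : ¬ a + i ≤ a := by omega
      simp only [hx', this, if_false]
      congr 1
      omega
  refine Nat.find_min hex (m := a + (k - b)) (by omega) ⟨x', fun i hi => ?_, ?_, ?_⟩
  · rcases lt_or_ge i a with h1 | h1
    · simpa [hx', h1.le, Nat.succ_le_of_lt h1] using hx i (by omega)
    · obtain ⟨j, rfl⟩ := Nat.exists_eq_add_of_le h1
      rw [add_assoc, hx'a, hx'a]
      exact hx (b + j) (by omega)
  · rw [hx'a, Nat.add_sub_of_le hbk]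
    exact hx0
  · have := ladderTop_shift_le hω (x := x) (x' := x') (a := a) (b := b) hx'a
      (by rwa [ladderTop_congr hω (x := x') (x' := x) fun i hi => by simp [hx', hi]]) (k - b)
    rw [Nat.add_sub_of_le hbk] at this
    exact hxh.trans this

end Ladder

/-! ### Codes of ladders -/

/-- A code of a ladder: in each column, whether the direction is reversed, and the length of the
climb. -/
abbrev Code (k : ℕ) : Type := Fin (k + 1) → Bool × ℕ

namespace Code

variable {k : ℕ} (c : Code k)

/-- The entries of a code, extended to all natural numbers. -/
def entry (i : ℕ) : Bool × ℕ := if h : i < k + 1 then c ⟨i, h⟩ else default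

/-- The steps of the ladder. -/
def step : ℕ → ℤ
  | 0 => if (c.entry 0).1 then 1 else -1
  | i + 1 => if (c.entry (i + 1)).1 then -step i else step i

/-- The columns of the ladder, which ends at the origin. -/
def column (i : ℕ) : ℤ := -∑ j ∈ Finset.Ico i k, c.step j

/-- The length of the climb in the `i`th column. A climb between two opposite steps has length at
least `3`. -/
def rise (i : ℕ) : ℕ := (c.entry i).2 + if 0 < i ∧ i < k ∧ (c.entry i).1 then 3 else 0

/-- The height at which the ladder enters its `i`th column. -/
def height (i : ℕ) : ℤ := ∑ j ∈ Finset.range i, (c.rise j : ℤ) - i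

/-- The sites of the climbs of a ladder are distinct. -/
def IsValid : Prop :=
  ∀ a b, a < b → b ≤ k → c.column a = c.column b → c.height a + c.rise a < c.height b

/-- The sites of the climbs. -/
def closedSites : Finset (ℤ × ℤ) :=
  (Finset.range (k + 1)).biUnion fun i =>
    (Finset.Ioc (c.height i) (c.height i + c.rise i)).image fun z => (c.column i, z)

/-- The sites on top of the climbs. -/
def openSites : Finset (ℤ × ℤ) :=
  (Finset.range k).image fun i => (c.column i, c.height i + c.rise i + 1)

lemma height_succ (i : ℕ) : c.height (i + 1) = c.height i + c.rise i - 1 := by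
  simp only [height, Finset.sum_range_succ]
  push_cast
  ring

variable {c}

/-- Validity makes each later climb in a column start at or above the open site on top of every
earlier one, so no site is counted twice. -/
lemma card_closedSites (hc : c.IsValid) :
    c.closedSites.card = ∑ i ∈ Finset.range (k + 1), c.rise i := by
  have key : ∀ a b, a < b → b ≤ k → Disjoint
      ((Finset.Ioc (c.height a) (c.height a + c.rise a)).image fun z => (c.column a, z))
      ((Finset.Ioc (c.height b) (c.height b + c.rise b)).image fun z => (c.column b, z)) := by
    intro a b hab hb
    rw [Finset.disjoint_left]
    rintro ⟨x, y⟩ h1 h2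
    simp only [Finset.mem_image, Finset.mem_Ioc, Prod.mk.injEq] at h1 h2
    obtain ⟨z, hz, hxa, rfl⟩ := h1
    obtain ⟨z', hz', hxb, rfl⟩ := h2
    have := hc a b hab hb (hxa.trans hxb.symm)
    linarith [hz.2, hz'.1]
  rw [closedSites, Finset.card_biUnion]
  · refine Finset.sum_congr rfl fun i _ => ?_
    rw [Finset.card_image_of_injective _ fun a b hab => by simpa using hab]
    simp
  · intro a ha b hb hab
    rw [Finset.mem_coe, Finset.mem_range] at ha hb
    rcases hab.lt_or_gt with h | h
    · exact key a b h (by omega)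
    · exact (key b a h (by omega)).symm

lemma card_openSites (hc : c.IsValid) : c.openSites.card = k := by
  rw [openSites, Finset.card_image_of_injOn, Finset.card_range]
  have key : ∀ a b, a < b → b < k →
      (c.column a, c.height a + c.rise a + 1) ≠ (c.column b, c.height b + c.rise b + 1) := by
    intro a b hab hb h
    rw [Prod.mk.injEq] at h
    have := hc a b hab hb.le h.1
    linarith [h.2, Int.natCast_nonneg (c.rise b)]
  intro a ha b hb hab
  simp only [Finset.coe_range, Set.mem_Iio] at ha hb
  by_contra hne
  rcases Nat.lt_or_gt_of_ne hne with h | h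
  · exact key a b h hb hab
  · exact key b a h ha hab.symm

lemma disjoint_sites (hc : c.IsValid) : Disjoint c.closedSites c.openSites := by
  rw [Finset.disjoint_left]
  rintro ⟨x, y⟩ h1 h2
  simp only [closedSites, openSites, Finset.mem_biUnion, Finset.mem_image, Finset.mem_Ioc,
    Finset.mem_range, Prod.mk.injEq] at h1 h2
  obtain ⟨a, ha, z, hz, hxa, rfl⟩ := h1
  obtain ⟨b, hb, hxb, hyb⟩ := h2
  rcases lt_trichotomy a b with h | rfl | h
  · have := hc a b h hb.le (hxa.trans hxb.symm)
    linarith [hz.2, Int.natCast_nonneg (c.rise b)]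
  · linarith [hz.2]
  · have := hc b a h (by omega) (hxb.trans hxa.symm)
    linarith [hz.1]

end Code

/-- If there is no open Lipschitz function, then there are ladders to arbitrary heights. -/
lemma exists_code {ω : Config (ℤ × ℤ)} (hω : NoClosedRay ω) (hlip : ω ∉ lipschitzEvent) (h : ℕ) :
    ∃ k, ∃ c : Code k, c.IsValid ∧ k + h ≤ ∑ i ∈ Finset.range (k + 1), c.rise i ∧
      (∀ v ∈ c.closedSites, ω v = false) ∧ ∀ v ∈ c.openSites, ω v = true := by
  have hex : ∃ k x, IsWalk x k ∧ x k = 0 ∧ (h : ℤ) ≤ ladderTop hω x k := by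
    by_contra hne
    refine hlip (mem_lipschitzEvent_of_bounded hω (h := h) fun k x hx hx0 => ?_)
    by_contra hlt
    exact hne ⟨k, x, hx, hx0, not_lt.1 hlt⟩
  obtain ⟨k, x, hx, hx0, hxh, hmin⟩ := exists_minimal_ladder hω hex
  -- The last climb is cut at height `h`, or at its entry if that is higher. The site on top of it
  -- then need not be open, which is why `openSites` omits index `k`.
  set t : ℕ → ℤ := fun i => if i < k then ladderTop hω x i else max h (ladderEntry hω x k) with ht
  have htlt : ∀ i < k, t i = ladderTop hω x i := fun i hi => by simp [ht, hi]
  have hte : ∀ i ≤ k, ladderEntry hω x i ≤ t i := by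
    intro i hi
    rcases hi.lt_or_eq with hi | rfl
    · rw [htlt i hi, ladderTop_eq]
      exact le_climb _ _ _
    · simp [ht]
  have htk : ∀ i ≤ k, t i ≤ ladderTop hω x i := by
    intro i hi
    rcases hi.lt_or_eq with hi | rfl
    · rw [htlt i hi]
    · simp only [ht, lt_irrefl, if_false, max_le_iff]
      exact ⟨hxh, by rw [ladderTop_eq]; exact le_climb _ _ _⟩
  set u : ℕ → ℕ := fun i => (t i - ladderEntry hω x i).toNat with hu
  have hut : ∀ i ≤ k, (u i : ℤ) = t i - ladderEntry hω x i := fun i hi => by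
    have := hte i hi
    simp only [hu]
    omega
  -- After a reversal the ladder re-enters column `x j`, by minimality strictly above its earlier
  -- top. As both moves go down by one, the climb between them makes up these two units and at least
  -- one more.
  have hrev : ∀ i, 0 < i → i < k → x (i + 1) - x i ≠ x i - x (i - 1) → 3 ≤ u i := by
    intro i hi hik hne
    obtain ⟨j, rfl⟩ : ∃ j, i = j + 1 := ⟨i - 1, by omega⟩
    have h1 := hx (j + 1) hik
    have h2 := hx j (by omega)
    rw [Nat.add_sub_cancel] at hne
    have hxx : x j = x (j + 1 + 1) := by
      rcases (abs_eq zero_le_one).1 h1 with h1 | h1 <;>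
        rcases (abs_eq zero_le_one).1 h2 with h2 | h2 <;> omega
    have h3 := hmin j (j + 1 + 1) (by omega) (by omega) hxx
    have h4 := hut (j + 1) hik.le
    rw [htlt _ hik] at h4
    simp only [ladderEntry] at h3 h4
    omega
  -- The flag at 0 records the first direction, the later flags record reversals; the number is the
  -- climb without its compulsory 3. The flag at `k` looks outside the walk, but affects neither
  -- columns nor rises.
  set c : Code k := fun i =>
    (if (i : ℕ) = 0 then decide (x 1 - x 0 = 1)
      else decide (x (i + 1) - x i ≠ x i - x (i - 1)),
      u i - if 0 < (i : ℕ) ∧ (i : ℕ) < k ∧ x (i + 1) - x i ≠ x i - x (i - 1) then 3 else 0) with hc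
  have hentry : ∀ i ≤ k, c.entry i = (if i = 0 then decide (x 1 - x 0 = 1)
      else decide (x (i + 1) - x i ≠ x i - x (i - 1)),
      u i - if 0 < i ∧ i < k ∧ x (i + 1) - x i ≠ x i - x (i - 1) then 3 else 0) := by
    intro i hi
    rw [Code.entry, dif_pos (Nat.lt_succ_of_le hi)]
  have hstep : ∀ i < k, c.step i = x (i + 1) - x i := by
    intro i hi
    induction i with
    | zero =>
      rw [Code.step, hentry 0 (Nat.zero_le k)]
      simp only [if_true, decide_eq_true_eq]
      rcases (abs_eq zero_le_one).1 (hx 0 hi) with h1 | h1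
      · rw [zero_add] at h1
        simp [h1]
      · rw [zero_add] at h1
        simp [h1]
    | succ i ih =>
      rw [Code.step, hentry _ hi.le, ih (by omega)]
      simp only [Nat.succ_ne_zero, if_false, decide_eq_true_eq, Nat.add_sub_cancel]
      rcases (abs_eq zero_le_one).1 (hx i (by omega)) with h1 | h1 <;>
        rcases (abs_eq zero_le_one).1 (hx (i + 1) hi) with h2 | h2 <;> rw [h1, h2] <;> simp
  have hcol : ∀ i ≤ k, c.column i = x i := by
    intro i hi
    rw [Code.column, Finset.sum_congr rfl fun j hj => hstep j (Finset.mem_Ico.1 hj).2,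
      Finset.sum_Ico_sub _ hi, hx0]
    ring
  have hrise : ∀ i ≤ k, c.rise i = u i := by
    intro i hi
    rw [Code.rise, hentry i hi]
    by_cases hcond : 0 < i ∧ i < k ∧ x (i + 1) - x i ≠ x i - x (i - 1)
    · have h0 : i ≠ 0 := by omega
      have := hrev i hcond.1 hcond.2.1 hcond.2.2
      simp only [h0, if_false, decide_eq_true_eq, hcond, not_false_eq_true, and_self, if_true, ne_eq]
      omega
    · have : ¬ (0 < i ∧ i < k ∧ (if i = 0 then decide (x 1 - x 0 = 1)
          else decide (x (i + 1) - x i ≠ x i - x (i - 1))) = true) := by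
        rintro ⟨h1, h2, h3⟩
        rw [if_neg (by omega), decide_eq_true_eq] at h3
        exact hcond ⟨h1, h2, h3⟩
      rw [if_neg hcond, if_neg this]
      simp
  have hheight : ∀ i ≤ k, c.height i = ladderEntry hω x i := by
    intro i hi
    induction i with
    | zero => simp [Code.height, ladderEntry]
    | succ i ih =>
      rw [Code.height_succ, ih (by omega), hrise i (by omega), hut i (by omega), htlt i (by omega),
        ladderEntry]
      ring
  have htop : ∀ i ≤ k, c.height i + c.rise i = t i := fun i hi => by
    rw [hheight i hi, hrise i hi, hut i hi]
    ring
  refine ⟨k, c, fun a b hab hb hcab => ?_, ?_, fun v hv => ?_, fun v hv => ?_⟩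
  · rw [htop a (by omega), htlt a (by omega), hheight b hb]
    exact hmin a b hab hb (by rwa [hcol a (by omega), hcol b hb] at hcab)
  · have h1 : (h : ℤ) ≤ t k := by simp [ht]
    have h2 := htop k le_rfl
    rw [Code.height] at h2
    rw [Finset.sum_range_succ]
    zify
    linarith
  · simp only [Code.closedSites, Finset.mem_biUnion, Finset.mem_range, Finset.mem_image,
      Finset.mem_Ioc] at hv
    obtain ⟨i, hi, z, hz, rfl⟩ := hv
    have hi : i ≤ k := by omega
    rw [hheight i hi, ← hheight i hi, htop i hi, hheight i hi] at hz
    rw [hcol i hi]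
    refine climb_closed hω hz.1 ?_
    rw [← ladderTop_eq]
    exact hz.2.trans (htk i hi)
  · simp only [Code.openSites, Finset.mem_image, Finset.mem_range] at hv
    obtain ⟨i, hi, rfl⟩ := hv
    rw [htop i hi.le, htlt i hi, hcol i hi.le, ladderTop_eq]
    exact climb_open hω _ _

/-! ### The Peierls argument -/

lemma tsum_prod_eq {α γ : Type} (f : α × γ → ℝ≥0∞) : ∑' x, f x = ∑' a, ∑' b, f (a, b) :=
  ENNReal.tsum_prod (f := fun a b => f (a, b))

lemma tsum_fin_prod {α : Type} : ∀ (n : ℕ) (w : Fin n → α → ℝ≥0∞),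
    ∑' c : Fin n → α, ∏ i, w i (c i) = ∏ i, ∑' a, w i a
  | 0, w => by simp
  | n + 1, w => by
    rw [← (Fin.consEquiv fun _ : Fin (n + 1) => α).tsum_eq, tsum_prod_eq,
      Fin.prod_univ_succ, ← tsum_fin_prod n, ← ENNReal.tsum_mul_right]
    refine tsum_congr fun a => ?_
    rw [← ENNReal.tsum_mul_left]
    refine tsum_congr fun f => ?_
    simp [Fin.consEquiv, Fin.prod_univ_succ]

/-- The generating function of the climbs, a climb after a reversal having length at least `3`. -/
def climbSum (d : ℝ≥0∞) : ℝ≥0∞ := (1 + d ^ 3) * (1 - d)⁻¹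

lemma tsum_climb (d : ℝ≥0∞) :
    ∑' a : Bool × ℕ, d ^ (a.2 + if a.1 then 3 else 0) = climbSum d := by
  rw [tsum_prod_eq, tsum_bool]
  simp only [Bool.false_eq_true, if_false, if_true, add_zero, pow_add]
  rw [ENNReal.tsum_mul_right, ENNReal.tsum_geometric, climbSum]
  ring

lemma tsum_climb_end (d : ℝ≥0∞) :
    ∑' a : Bool × ℕ, d ^ a.2 ≤ 2 * climbSum d := by
  rw [tsum_prod_eq, tsum_bool]
  simp only
  rw [ENNReal.tsum_geometric, climbSum, ← two_mul]
  gcongr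
  exact le_mul_of_one_le_left zero_le (by simp)

/-- The weight is a product over columns, so the sum factorises. In the two end columns the flag
carries no weight, which costs a factor of at most 2 each; for `k = 0` a single column carries both
factors. -/
lemma tsum_code_le (d : ℝ≥0∞) (k : ℕ) :
    ∑' c : Code k, d ^ ∑ i ∈ Finset.range (k + 1), c.rise i ≤ 4 * climbSum d ^ (k + 1) := by
  have h1 : ∀ c : Code k, d ^ ∑ i ∈ Finset.range (k + 1), c.rise i =
      ∏ i : Fin (k + 1), d ^ ((c i).2 + if 0 < (i : ℕ) ∧ (i : ℕ) < k ∧ (c i).1 then 3 else 0) := by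
    intro c
    rw [← Finset.prod_pow_eq_pow_sum, ← Fin.prod_univ_eq_prod_range fun i => d ^ c.rise i]
    refine Finset.prod_congr rfl fun i _ => ?_
    simp only [Code.rise, Code.entry, i.2, dif_pos]
  simp_rw [h1]
  rw [tsum_fin_prod (α := Bool × ℕ) (k + 1) fun i a =>
    d ^ (a.2 + if 0 < (i : ℕ) ∧ (i : ℕ) < k ∧ a.1 then 3 else 0)]
  have h2 : ∀ i : Fin (k + 1),
      ∑' a : Bool × ℕ, d ^ (a.2 + if 0 < (i : ℕ) ∧ (i : ℕ) < k ∧ a.1 then 3 else 0) ≤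
        ((if i = 0 then 2 else 1) * (if i = Fin.last k then 2 else 1)) * climbSum d := by
    intro i
    by_cases h : 0 < (i : ℕ) ∧ (i : ℕ) < k
    · have h0 : i ≠ 0 := by rintro rfl; simp at h
      have hk : i ≠ Fin.last k := by rintro rfl; simp at h
      simp only [h, true_and, h0, hk, if_false, one_mul, tsum_climb, le_refl]
    · have h' : ∀ a : Bool × ℕ, ¬ (0 < (i : ℕ) ∧ (i : ℕ) < k ∧ a.1) := fun a H => h ⟨H.1, H.2.1⟩
      simp only [h', if_false, add_zero]
      refine (tsum_climb_end d).trans ?_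
      gcongr
      by_cases h0 : i = 0
      · rw [if_pos h0]
        split_ifs <;> norm_num
      · have : i = Fin.last k := by
          have hi := i.2
          have : (i : ℕ) ≠ 0 := fun e => h0 (Fin.ext e)
          ext
          simp only [Fin.val_last]
          omega
        rw [if_pos this, if_neg h0, one_mul]
  refine (Finset.prod_le_prod' fun i _ => h2 i).trans ?_
  rw [Finset.prod_mul_distrib, Finset.prod_mul_distrib, Finset.prod_ite_eq', Finset.prod_ite_eq']
  simp only [Finset.mem_univ, if_true, Finset.prod_const, Finset.card_univ, Fintype.card_fin]
  norm_num

section Peierls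

variable {Ω : Type*} [MeasurableSpace Ω] {μ : Measure Ω} {β : Ω → Config (ℤ × ℤ)} {q p : ℝ≥0∞}

lemma ae_noClosedRay (hq : q < 1) (H : ∀ S T : Finset (ℤ × ℤ), Disjoint S T →
    μ {ω | (∀ v ∈ S, β ω v = false) ∧ ∀ v ∈ T, β ω v = true} ≤ q ^ S.card * p ^ T.card) :
    ∀ᵐ ω ∂μ, NoClosedRay (β ω) := by
  simp_rw [NoClosedRay, ae_all_iff]
  intro x y
  refine le_antisymm (ge_of_tendsto' (ENNReal.tendsto_pow_atTop_nhds_zero_of_lt_one hq)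
    fun n => ?_) zero_le
  have := H ((Finset.range n).image fun i : ℕ => ((x, y + i + 1) : ℤ × ℤ)) ∅ (by simp)
  rw [Finset.card_image_of_injective _ fun i j hij => by simpa using hij, Finset.card_range,
    Finset.card_empty, pow_zero, mul_one] at this
  refine (measure_mono fun ω hω => ?_).trans this
  have hω' : ¬ ∃ n : ℕ, β ω (x, y + n + 1) = true := hω
  push Not at hω'
  simpa using fun i _ => hω' i

/-- Multiply by `2 ^ (U - k - h) ≥ 1`. This exchanges the constraint `k + h ≤ U` for the decay `(1 /
2) ^ h` and leaves unconstrained weights that can be summed over all codes. -/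
lemma weight_le {k h U : ℕ} (hU : k + h ≤ U) :
    q ^ U * p ^ k ≤ (1 / 2) ^ h * ((2 * q) ^ U * (p / 2) ^ k) := by
  have h2 : (1 / 2 : ℝ≥0∞) * 2 = 1 := by
    rw [one_div]; exact ENNReal.inv_mul_cancel two_ne_zero ENNReal.ofNat_ne_top
  obtain ⟨j, rfl⟩ := Nat.exists_eq_add_of_le hU
  calc q ^ (k + h + j) * p ^ k ≤ q ^ (k + h + j) * p ^ k * 2 ^ j :=
        le_mul_of_one_le_right zero_le (one_le_pow_of_one_le' one_le_two j)
    _ = ((1 / 2) * 2) ^ h * ((1 / 2) * 2) ^ k * (q ^ (k + h + j) * p ^ k * 2 ^ j) := by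
        rw [h2]; simp
    _ = (1 / 2) ^ h * ((2 * q) ^ (k + h + j) * (p * (1 / 2)) ^ k) := by ring
    _ = _ := by rw [mul_one_div]

/-- **Peierls argument**: if closed sites are rare enough, then there is an open Lipschitz
function. -/
theorem ae_mem_lipschitzEvent (hq : 2 * q < 1) (hz : climbSum (2 * q) * (p / 2) < 1)
    (H : ∀ S T : Finset (ℤ × ℤ), Disjoint S T →
      μ {ω | (∀ v ∈ S, β ω v = false) ∧ ∀ v ∈ T, β ω v = true} ≤ q ^ S.card * p ^ T.card) :
    ∀ᵐ ω ∂μ, β ω ∈ lipschitzEvent := by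
  have hq1 : q < 1 := lt_of_le_of_lt (le_mul_of_one_le_left zero_le one_le_two) hq
  set d := 2 * q with hd
  set C : ℝ≥0∞ := 4 * climbSum d * (1 - climbSum d * (p / 2))⁻¹ with hC
  have hclimb : climbSum d ≠ ∞ := by
    rw [climbSum]
    refine ENNReal.mul_ne_top (by finiteness) (ENNReal.inv_ne_top.2 (tsub_pos_of_lt hq).ne')
  have hCtop : C ≠ ∞ :=
    ENNReal.mul_ne_top (by finiteness) (ENNReal.inv_ne_top.2 (tsub_pos_of_lt hz).ne')
  set E : ℕ → Set Ω := fun h => {ω | ∃ k, ∃ c : Code k, c.IsValid ∧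
    k + h ≤ ∑ i ∈ Finset.range (k + 1), c.rise i ∧
      (∀ v ∈ c.closedSites, β ω v = false) ∧ ∀ v ∈ c.openSites, β ω v = true} with hE
  have hcode : ∀ (h k : ℕ) (c : Code k), μ {ω | c.IsValid ∧
      k + h ≤ ∑ i ∈ Finset.range (k + 1), c.rise i ∧
        (∀ v ∈ c.closedSites, β ω v = false) ∧ ∀ v ∈ c.openSites, β ω v = true} ≤
      (1 / 2) ^ h * (d ^ (∑ i ∈ Finset.range (k + 1), c.rise i) * (p / 2) ^ k) := by
    intro h k c
    by_cases hc : c.IsValid ∧ k + h ≤ ∑ i ∈ Finset.range (k + 1), c.rise i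
    · refine (measure_mono fun ω hω => hω.2.2).trans ((H _ _ (Code.disjoint_sites hc.1)).trans ?_)
      rw [Code.card_closedSites hc.1, Code.card_openSites hc.1]
      exact weight_le hc.2
    · refine (measure_mono_null (t := ∅) (fun ω hω => hc ⟨hω.1, hω.2.1⟩)
        measure_empty).le.trans zero_le
  have hbound : ∀ h, μ (E h) ≤ (1 / 2) ^ h * C := by
    intro h
    have hsub : E h = ⋃ k, ⋃ c : Code k, {ω | c.IsValid ∧
        k + h ≤ ∑ i ∈ Finset.range (k + 1), c.rise i ∧
          (∀ v ∈ c.closedSites, β ω v = false) ∧ ∀ v ∈ c.openSites, β ω v = true} := by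
      ext ω; simp [hE]
    calc μ (E h) ≤ ∑' k, ∑' c : Code k, (1 / 2) ^ h *
          (d ^ (∑ i ∈ Finset.range (k + 1), c.rise i) * (p / 2) ^ k) := by
          rw [hsub]
          exact (measure_iUnion_le _).trans (ENNReal.tsum_le_tsum fun k =>
            (measure_iUnion_le _).trans (ENNReal.tsum_le_tsum fun c => hcode h k c))
      _ = (1 / 2) ^ h * ∑' k, (∑' c : Code k, d ^ ∑ i ∈ Finset.range (k + 1), c.rise i) *
          (p / 2) ^ k := by
          simp_rw [ENNReal.tsum_mul_left, ENNReal.tsum_mul_right]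
      _ ≤ (1 / 2) ^ h * ∑' k, (4 * climbSum d) * (climbSum d * (p / 2)) ^ k := by
          refine mul_le_mul_right (ENNReal.tsum_le_tsum fun k => ?_) _
          calc _ ≤ 4 * climbSum d ^ (k + 1) * (p / 2) ^ k := by
                gcongr
                exact tsum_code_le d k
            _ = _ := by rw [mul_pow]; ring
      _ = (1 / 2) ^ h * C := by rw [ENNReal.tsum_mul_left, ENNReal.tsum_geometric]
  -- Without an open Lipschitz function there are ladders to every height, so all the events `E h`
  -- occur, and their probabilities tend to 0.
  have hnull : μ (⋂ h, E h) = 0 := by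
    have h1 : Tendsto (fun h : ℕ => (1 / 2 : ℝ≥0∞) ^ h * C) atTop (𝓝 (0 * C)) :=
      ENNReal.Tendsto.mul_const (ENNReal.tendsto_pow_atTop_nhds_zero_of_lt_one
        (by rw [one_div]; exact ENNReal.one_half_lt_one)) (Or.inr hCtop)
    rw [zero_mul] at h1
    exact le_antisymm (ge_of_tendsto' h1 fun h =>
      (measure_mono (Set.iInter_subset _ h)).trans (hbound h)) zero_le
  filter_upwards [ae_noClosedRay hq1 H, measure_eq_zero_iff_ae_notMem.1 hnull] with ω h1 h2
  by_contra hlip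
  exact h2 (Set.mem_iInter.2 fun h => exists_code h1 hlip h)

end Peierls

/-! ### The numerical condition of the Peierls argument -/

lemma climbSum_mul_lt_one {q p : ℝ} (hq : 0 ≤ q) (hq2 : 2 * q < 1)
    (h : (1 + (2 * q) ^ 3) * p < 2 * (1 - 2 * q)) :
    climbSum (2 * ENNReal.ofReal q) * (ENNReal.ofReal p / 2) < 1 := by
  have e1 : (2 : ℝ≥0∞) * ENNReal.ofReal q = ENNReal.ofReal (2 * q) := by
    rw [ENNReal.ofReal_mul zero_le_two]; simp
  have h1 : 0 < 1 - 2 * q := by linarith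
  have e2 : (1 + ENNReal.ofReal (2 * q) ^ 3) * (1 - ENNReal.ofReal (2 * q))⁻¹ *
      (ENNReal.ofReal p / 2) = ENNReal.ofReal ((1 + (2 * q) ^ 3) * (1 - 2 * q)⁻¹ * (p / 2)) := by
    rw [ENNReal.ofReal_mul (mul_nonneg (by positivity) (inv_nonneg.2 h1.le)),
      ENNReal.ofReal_mul (p := 1 + (2 * q) ^ 3) (by positivity), ENNReal.ofReal_add zero_le_one (by positivity), ENNReal.ofReal_pow (by positivity),
      ENNReal.ofReal_inv_of_pos h1, ENNReal.ofReal_sub _ (by positivity),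
      ENNReal.ofReal_div_of_pos two_pos]
    simp
  rw [climbSum, e1, e2, ← ENNReal.ofReal_one, ENNReal.ofReal_lt_ofReal_iff one_pos]
  rw [show (1 + (2 * q) ^ 3) * (1 - 2 * q)⁻¹ * (p / 2) =
    ((1 + (2 * q) ^ 3) * p) / (2 * (1 - 2 * q)) by field_simp]
  rw [div_lt_one (by linarith)]
  exact h

/-- Open Lipschitz functions exist if the density of the open sites is larger than `0.7491`. -/
theorem ae_mem_lipschitzEvent_of_lt {p : unitInterval} (hp : 0.7491 < (p : ℝ)) :
    ∀ᵐ ω ∂siteLaw (ℤ × ℤ) p, ω ∈ lipschitzEvent := by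
  have hp1 := p.2.2
  refine ae_mem_lipschitzEvent (β := id) (q := ENNReal.ofReal (1 - p)) (p := ENNReal.ofReal p) ?_
    (climbSum_mul_lt_one (by linarith) (by norm_num at hp ⊢; linarith) ?_)
    fun S T hST => (siteLaw_cylinder p S T hST).le
  · rw [show (2 : ℝ≥0∞) = ENNReal.ofReal 2 by simp, ← ENNReal.ofReal_mul zero_le_two,
      ← ENNReal.ofReal_one, ENNReal.ofReal_lt_ofReal_iff one_pos]
    norm_num at hp ⊢
    linarith
  -- With `p = 1 - q` the condition reads `3 q + 8 q ^ 3 - 8 q ^ 4 < 1`. It holds with room to spare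
  -- for `q ≤ 0.2509`, even without the quartic term.
  · obtain ⟨q, hq⟩ : ∃ q : ℝ, q = 1 - p := ⟨_, rfl⟩
    have hpq : (p : ℝ) = 1 - q := by linarith
    rw [hpq] at hp hp1 ⊢
    have h0 : 0 ≤ q := by linarith
    have h1 : q ≤ 0.2509 := by norm_num at hp ⊢; linarith
    have h2 : q ^ 2 ≤ 0.2509 ^ 2 := by gcongr
    have h3 : q ^ 3 ≤ 0.2509 ^ 3 := by gcongr
    have h4 : 0 ≤ q ^ 4 := by positivity
    norm_num at h1 h2 h3 ⊢
    nlinarith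

/-! ### Concentration of the edge -/

/-- If the edge has positive speed, then its displacements in `N` and in `2 * N` steps are close to
`4 * h * (20 / 21)` and twice this with probability close to `1`, for suitable `N` and `h`. -/
lemma exists_edge_concentration (p : unitInterval) (hp : 0 < (p : ℝ)) {c : ℝ} (hc : 0 < c)
    (hspeed : ∀ n : ℕ, c * n ≤ meanEdge p n) :
    ∃ L : ℕ, ∀ ε : ℝ, 0 < ε → ∃ N h : ℕ, 0 < N ∧ 0 < h ∧ N ≤ L * h ∧
      siteLaw (ℤ × ℤ) p {ω | (4 * h : ℤ) ≤ edge ω 0 0 N} ≤ ENNReal.ofReal ε ∧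
      siteLaw (ℤ × ℤ) p {ω | edge ω 0 0 (2 * N) < 6 * h} ≤ ENNReal.ofReal ε := by
  set R : Set ℝ := (fun n : ℕ => meanEdge p n / n) '' Set.Ici 1 with hR
  have hRc : ∀ x ∈ R, c ≤ x := by
    rintro _ ⟨n, hn, rfl⟩
    have : (0 : ℝ) < n := by exact_mod_cast (show 0 < n from hn)
    rw [le_div_iff₀ this]
    exact hspeed n
  have hRne : R.Nonempty := ⟨_, 1, Set.mem_Ici.2 le_rfl, rfl⟩
  set α := sInf R with hα
  have hcα : c ≤ α := le_csInf hRne hRc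
  have hα0 : 0 < α := hc.trans_le hcα
  have hmean : ∀ n : ℕ, α * n ≤ meanEdge p n := by
    intro n
    rcases Nat.eq_zero_or_pos n with rfl | hn
    · simpa using hspeed 0
    · have : (0 : ℝ) < n := by exact_mod_cast hn
      rw [← le_div_iff₀ this]
      exact csInf_le ⟨c, hRc⟩ ⟨n, hn, rfl⟩
  -- The aspect ratio bound must not depend on `ε`, because the required `ε` will depend on the
  -- number of block colours, and hence on `L`. It works since `4 h` is at least `(21 / 20) α N` and
  -- `α ≥ c`.
  refine ⟨⌈4 / c⌉₊, fun ε hε => ?_⟩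
  set η := α / 20 with hη
  have hη0 : 0 < η := by positivity
  set δ := min η (η * ε / 2) with hδ
  have hδ0 : 0 < δ := lt_min hη0 (by positivity)
  have hδη : δ ≤ η := min_le_left _ _
  have hδε : δ ≤ η * ε / 2 := min_le_right _ _
  -- `α` is the infimum of the average speeds. A nearly optimal `m` makes speeds above `α + δ`
  -- exponentially unlikely.
  obtain ⟨_, ⟨m, hm, rfl⟩, hmlt⟩ := exists_lt_of_csInf_lt hRne (show α < α + δ by linarith)
  have hm1 : 1 ≤ m := hm
  have hm0 : (0 : ℝ) < m := by exact_mod_cast (show 0 < m from hm)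
  obtain ⟨θ, hθ, hdev⟩ := edge_large_deviation p hp m ((div_lt_iff₀ hm0).1 hmlt)
  have hε' : (0 : ℝ≥0∞) < ENNReal.ofReal (min ε (η * ε / 2)) :=
    ENNReal.ofReal_pos.2 (lt_min hε (by positivity))
  obtain ⟨K, hK⟩ := eventually_atTop.1
    ((ENNReal.tendsto_pow_atTop_nhds_zero_of_lt_one hθ).eventually (gt_mem_nhds hε'))
  obtain ⟨K', hK'⟩ := exists_nat_ge (20 / α)
  set k := max (max K K') 1 with hk
  have hkK : K ≤ k := (le_max_left _ _).trans (le_max_left _ _)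
  have hkK' : K' ≤ k := (le_max_right _ _).trans (le_max_left _ _)
  have hk1 : 1 ≤ k := le_max_right _ _
  set N := m * k with hN
  have hN0 : 0 < N := Nat.mul_pos hm hk1
  have hNr : (0 : ℝ) < N := by exact_mod_cast hN0
  have hαN : 20 ≤ α * N := by
    have h1 : (K' : ℝ) ≤ N := by
      exact_mod_cast hkK'.trans (Nat.le_mul_of_pos_left k hm)
    rw [div_le_iff₀ hα0] at hK'
    nlinarith
  -- With `η = α / 20`, this gives `4 h ≥ (α + η) N`. Since `α N ≥ 20` absorbs the rounding, also `6
  -- h < (α - η) (2 N)`.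
  set h := ⌈21 / 80 * (α * N)⌉₊ with hh
  have hh1 : 21 / 80 * (α * N) ≤ h := Nat.le_ceil _
  have hh2 : (h : ℝ) < 21 / 80 * (α * N) + 1 := Nat.ceil_lt_add_one (by positivity)
  have hup : ∀ j : ℕ, k ≤ j → siteLaw (ℤ × ℤ) p
      {ω | (α + δ) * (m * j : ℕ) ≤ edge ω 0 0 (m * j)} ≤
        ENNReal.ofReal (min ε (η * ε / 2)) := by
    intro j hj
    refine le_trans (measure_mono fun ω hω => ?_) ((hdev j).trans (hK j (hkK.trans hj)).le)
    simp only [Set.mem_ofPred_eq] at hω ⊢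
    push_cast at hω
    linarith
  refine ⟨N, h, hN0, ?_, ?_, ?_, ?_⟩
  · have : (0 : ℝ) < h := by nlinarith
    exact_mod_cast this
  · have h1 : (4 / c : ℝ) ≤ ⌈4 / c⌉₊ := Nat.le_ceil _
    have h2 : (N : ℝ) ≤ 4 / c * h := by
      rw [div_mul_eq_mul_div, le_div_iff₀ hc]
      nlinarith
    have h3 : (N : ℝ) ≤ ⌈4 / c⌉₊ * h := h2.trans (by gcongr)
    exact_mod_cast h3
  · refine le_trans (measure_mono fun ω hω => ?_) ((hup k le_rfl).trans
      (ENNReal.ofReal_le_ofReal (min_le_left _ _)))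
    simp only [Set.mem_ofPred_eq] at hω ⊢
    have : (4 * h : ℝ) ≤ edge ω 0 0 N := by exact_mod_cast hω
    have h1 : δ * N ≤ η * N := by gcongr
    rw [← hN]
    nlinarith
  · have hb := (hup (2 * k) (by omega)).trans (ENNReal.ofReal_le_ofReal (min_le_right _ _))
    rw [show m * (2 * k) = 2 * N by rw [hN]; ring] at hb
    set A : Set (Config (ℤ × ℤ)) := {ω | (α + δ) * (2 * N : ℕ) ≤ edge ω 0 0 (2 * N)} with hA
    set B : Set (Config (ℤ × ℤ)) := {ω | (edge ω 0 0 (2 * N) : ℝ) < (α - η) * (2 * N : ℕ)} with hB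
    have hAm : MeasurableSet A := measurableSet_le measurable_const (measurable_edge_real _ _ _)
    have hBm : MeasurableSet B := measurableSet_lt (measurable_edge_real _ _ _) measurable_const
    set n : ℝ := ((2 * N : ℕ) : ℝ) with hn
    have hn0 : 0 < n := by rw [hn]; exact_mod_cast (show 0 < 2 * N by omega)
    -- The mean is at least `α n` and upward excesses are rare, so downward ones must be rare too.
    -- Taking expectations gives `(η + δ) P(B) ≤ δ + P(A) ≤ η ε`.
    have hpt : ∀ᵐ ω ∂siteLaw (ℤ × ℤ) p, (edge ω 0 0 (2 * N) : ℝ) ≤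
        (α + δ) * n + (A.indicator (fun _ => n) ω - B.indicator (fun _ => (η + δ) * n) ω) := by
      filter_upwards [ae_wet_nonempty p hp] with ω hω
      have h1 : (edge ω 0 0 (2 * N) : ℝ) ≤ n := by
        have := edge_le (hω 0 0 (2 * N))
        rw [zero_add] at this
        rw [hn]
        exact_mod_cast this
      by_cases hωA : ω ∈ A <;> by_cases hωB : ω ∈ B
      · simp only [hA, hB, Set.mem_ofPred_eq] at hωA hωB
        nlinarith
      · rw [Set.indicator_of_mem hωA, Set.indicator_of_notMem hωB]
        nlinarith
      · rw [Set.indicator_of_notMem hωA, Set.indicator_of_mem hωB]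
        simp only [hB, Set.mem_ofPred_eq] at hωB
        linarith
      · rw [Set.indicator_of_notMem hωA, Set.indicator_of_notMem hωB]
        simp only [hA, Set.mem_ofPred_eq, not_le] at hωA
        linarith
    have hiA : Integrable (A.indicator fun _ => n) (siteLaw (ℤ × ℤ) p) :=
      (integrable_const n).indicator hAm
    have hiB : Integrable (B.indicator fun _ => (η + δ) * n) (siteLaw (ℤ × ℤ) p) :=
      (integrable_const _).indicator hBm
    have hint := integral_mono_ae (integrable_edge p hp 0 0 (2 * N))
      ((integrable_const ((α + δ) * n)).add (hiA.sub hiB)) hpt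
    simp only [Pi.add_apply, Pi.sub_apply] at hint
    rw [integral_add (g := fun ω => A.indicator (fun _ => n) ω - B.indicator (fun _ => (η + δ) * n) ω)
      (integrable_const _) (hiA.sub hiB), integral_sub hiA hiB,
      integral_indicator_const _ hAm, integral_indicator_const _ hBm] at hint
    simp only [integral_const, probReal_univ, smul_eq_mul] at hint
    have hEn := hmean (2 * N)
    rw [← hn] at hEn
    rw [meanEdge] at hEn
    have hAε : (siteLaw (ℤ × ℤ) p).real A ≤ η * ε / 2 := by
      rw [measureReal_def]
      exact ENNReal.toReal_le_of_le_ofReal (by positivity) hb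
    have hB0 : 0 ≤ (siteLaw (ℤ × ℤ) p).real B := measureReal_nonneg
    have hBε : (siteLaw (ℤ × ℤ) p).real B ≤ ε := by
      have h1 : 0 ≤ n * (δ + (siteLaw (ℤ × ℤ) p).real A - (η + δ) * (siteLaw (ℤ × ℤ) p).real B) := by
        nlinarith
      have h2 := nonneg_of_mul_nonneg_right h1 hn0
      have h3 : η * (siteLaw (ℤ × ℤ) p).real B ≤ η * ε := by nlinarith
      exact le_of_mul_le_mul_left h3 hη0
    refine le_trans (measure_mono fun ω hω => ?_)
      (ENNReal.le_ofReal_iff_toReal_le (measure_ne_top _ B) hε.le |>.2 hBε)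
    simp only [hB, Set.mem_ofPred_eq] at hω ⊢
    have h1 : (edge ω 0 0 (2 * N) : ℝ) < 6 * h := by exact_mod_cast hω
    rw [hn]
    push_cast
    nlinarith

/-! ### Blocks -/

lemma abs_sub_le_of_steps {f : ℤ → ℤ} {a b : ℤ} (hf : ∀ x, a ≤ x → x < b → |f (x + 1) - f x| ≤ 1)
    {x y : ℤ} (hx : a ≤ x) (hxy : x ≤ y) (hy : y ≤ b) : |f y - f x| ≤ y - x := by
  induction y, hxy using Int.leInduction with
  | base => simp
  | succ y hxy ih =>
    have h1 := ih (by linarith)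
    have h2 := hf y (by linarith) (by linarith)
    rw [abs_le] at *
    constructor <;> linarith

/-- An open path in the columns `x₀ + 1, …, x₀ + 2 * N` that moves from below the height
`y₀ - 3 * h` to above the height `y₀ + 3 * h`, and that is close to `y₀` half-way. -/
structure IsUpPath (ω : Config (ℤ × ℤ)) (x₀ y₀ : ℤ) (N h : ℕ) (f : ℤ → ℤ) : Prop where
  step : ∀ x, x₀ ≤ x → x < x₀ + 2 * N → |f (x + 1) - f x| ≤ 1
  isOpen : ∀ x, x₀ < x → x ≤ x₀ + 2 * N → ω (x, f x) = true
  left : f x₀ ≤ y₀ - 3 * h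
  middle : |f (x₀ + N) - y₀| ≤ h
  right : y₀ + 3 * h ≤ f (x₀ + 2 * N)

lemma IsUpPath.abs_sub_le {ω : Config (ℤ × ℤ)} {x₀ y₀ : ℤ} {N h : ℕ} {f : ℤ → ℤ}
    (hf : IsUpPath ω x₀ y₀ N h f) {x : ℤ} (hx : x₀ ≤ x) (hx' : x ≤ x₀ + 2 * N) :
    |f x - y₀| ≤ h + N := by
  have h1 := hf.middle
  rcases le_total x (x₀ + N) with h | h
  · have := abs_sub_le_of_steps hf.step hx h (by linarith [Int.natCast_nonneg N])
    rw [abs_le] at *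
    constructor <;> linarith
  · have := abs_sub_le_of_steps hf.step (by linarith [Int.natCast_nonneg N]) h hx'
    rw [abs_le] at *
    constructor <;> linarith

/-- The event that there is a path as in `IsUpPath`. -/
def upEvent (x₀ y₀ : ℤ) (N h : ℕ) : Set (Config (ℤ × ℤ)) := {ω | ∃ f, IsUpPath ω x₀ y₀ N h f}

/-- The sites on which `upEvent` depends. -/
def box (x₀ y₀ : ℤ) (N h : ℕ) : Set (ℤ × ℤ) :=
  Set.Ioc x₀ (x₀ + 2 * N) ×ˢ Set.Icc (y₀ - (h + N)) (y₀ + (h + N))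

lemma dependsOn_upEvent (x₀ y₀ : ℤ) (N h : ℕ) :
    DependsOn (fun ω => ω ∈ upEvent x₀ y₀ N h) (box x₀ y₀ N h) := by
  have key : ∀ ω ω' : Config (ℤ × ℤ), (∀ v ∈ box x₀ y₀ N h, ω v = ω' v) →
      ω ∈ upEvent x₀ y₀ N h → ω' ∈ upEvent x₀ y₀ N h := by
    rintro ω ω' hω ⟨f, hf⟩
    refine ⟨f, hf.step, fun x hx hx' => ?_, hf.left, hf.middle, hf.right⟩
    have := abs_le.1 (hf.abs_sub_le hx.le hx')
    rw [← hω (x, f x) ⟨⟨hx, hx'⟩, by simp only; linarith, by simp only; linarith⟩]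
    exact hf.isOpen x hx hx'
  exact fun ω ω' hω => propext ⟨key ω ω' hω, key ω' ω fun v hv => (hω v hv).symm⟩

lemma finite_box (x₀ y₀ : ℤ) (N h : ℕ) : (box x₀ y₀ N h).Finite :=
  (Set.finite_Ioc _ _).prod (Set.finite_Icc _ _)

lemma measurableSet_of_dependsOn_finite {V : Type} {A : Set (Config V)} {S : Set V}
    (hS : S.Finite) (hA : DependsOn (fun ω => ω ∈ A) S) : MeasurableSet A := by
  classical
  have := hS.to_subtype
  have h1 : A = (fun (ω : Config V) (v : S) => ω v) ⁻¹'
      {g | (fun v => if h : v ∈ S then g ⟨v, h⟩ else false) ∈ A} := by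
    ext ω
    exact iff_of_eq (hA fun v hv => by simp [hv])
  rw [h1]
  exact (measurable_pi_lambda _ fun v => measurable_pi_apply _) (Set.toFinite _).measurableSet

/-- Take a path realising the edge after `2 N` columns. By `h1` it is not too high half-way. Were it
below `y₀ - h` there, `h2` would prevent it from climbing to `y₀ + 3 h` in the remaining `N`
columns. -/
lemma mem_upEvent {ω : Config (ℤ × ℤ)} {x₀ y₀ : ℤ} {N h : ℕ}
    (hne : (wet ω x₀ (y₀ - 3 * h) (2 * N)).Nonempty)
    (h1 : edge ω x₀ (y₀ - 3 * h) N < y₀ - 3 * h + 4 * h)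
    (h2 : edge ω (x₀ + N) (y₀ - h) N < y₀ - h + 4 * h)
    (h3 : y₀ - 3 * h + 6 * h ≤ edge ω x₀ (y₀ - 3 * h) (2 * N)) : ω ∈ upEvent x₀ y₀ N h := by
  obtain ⟨f, hf0, hfN, hf⟩ := mem_wet_iff.1 (edge_mem hne)
  have hmid := le_edge (mem_wet_iff.2 ⟨f, hf0, rfl, fun i hi => hf i (by omega)⟩ :
    f N ∈ wet ω x₀ (y₀ - 3 * h) N)
  have hmid' : y₀ - h ≤ f N := by
    by_contra hlt
    have := le_edge (mem_wet_iff.2 ⟨fun i => f (N + i), by simpa using (not_le.1 hlt).le, rfl,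
      fun i hi => ⟨(hf (N + i) (by omega)).1, by
        rw [← (hf (N + i) (by omega)).2]
        congr 2
        push_cast
        ring⟩⟩ : f (N + N) ∈ wet ω (x₀ + N) (y₀ - h) N)
    rw [← two_mul, hfN] at this
    linarith
  refine ⟨fun x => f (x - x₀).toNat, fun x hx hx' => ?_, fun x hx hx' => ?_, ?_, ?_, ?_⟩
  · have := (hf (x - x₀).toNat (by omega)).1
    rwa [← show (x + 1 - x₀).toNat = (x - x₀).toNat + 1 by omega] at this
  · have := (hf (x - x₀ - 1).toNat (by omega)).2
    rwa [← show (x - x₀).toNat = (x - x₀ - 1).toNat + 1 by omega,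
      show x₀ + ((x - x₀ - 1).toNat : ℤ) + 1 = x by omega] at this
  · simpa using hf0
  · simp only [add_sub_cancel_left, Int.toNat_natCast, abs_le]
    constructor <;> linarith
  · have : (x₀ + 2 * (N : ℤ) - x₀).toNat = 2 * N := by omega
    simp only [this, hfN]
    linarith

lemma siteLaw_edge_set (p : unitInterval) (hp : 0 < (p : ℝ)) (s h : ℤ) (n : ℕ) (A : Set ℤ) :
    siteLaw (ℤ × ℤ) p {ω | edge ω s h n - h ∈ A} = siteLaw (ℤ × ℤ) p {ω | edge ω 0 0 n ∈ A} := by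
  have h1 := congrArg (fun ν : Measure ℤ => ν A) (map_edge_sub p hp s h n)
  rw [Measure.map_apply ((measurable_edge s h n).sub_const h) (MeasurableSet.of_discrete),
    Measure.map_apply (measurable_edge 0 0 n) (MeasurableSet.of_discrete)] at h1
  exact h1

lemma siteLaw_upEvent_compl_le (p : unitInterval) (hp : 0 < (p : ℝ)) {N h : ℕ} {ε : ℝ≥0∞}
    (h1 : siteLaw (ℤ × ℤ) p {ω | (4 * h : ℤ) ≤ edge ω 0 0 N} ≤ ε)
    (h2 : siteLaw (ℤ × ℤ) p {ω | edge ω 0 0 (2 * N) < 6 * h} ≤ ε) (x₀ y₀ : ℤ) :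
    siteLaw (ℤ × ℤ) p (upEvent x₀ y₀ N h)ᶜ ≤ 3 * ε := by
  have hsub : ((upEvent x₀ y₀ N h)ᶜ : Set (Config (ℤ × ℤ))) ≤ᵐ[siteLaw (ℤ × ℤ) p]
      ({ω | edge ω x₀ (y₀ - 3 * h) N - (y₀ - 3 * h) ∈ Set.Ici (4 * h : ℤ)} ∪
        {ω | edge ω (x₀ + N) (y₀ - h) N - (y₀ - h) ∈ Set.Ici (4 * h : ℤ)} ∪
        {ω | edge ω x₀ (y₀ - 3 * h) (2 * N) - (y₀ - 3 * h) ∈ Set.Iio (6 * h : ℤ)} : Set _) := by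
    filter_upwards [ae_wet_nonempty p hp] with ω hω hup
    by_contra hnot
    have hnot' : ¬ ((4 * h : ℤ) ≤ edge ω x₀ (y₀ - 3 * h) N - (y₀ - 3 * h) ∨
      (4 * h : ℤ) ≤ edge ω (x₀ + N) (y₀ - h) N - (y₀ - h) ∨
      edge ω x₀ (y₀ - 3 * h) (2 * N) - (y₀ - 3 * h) < 6 * h) := fun H => hnot (or_assoc.2 H)
    push Not at hnot'
    exact hup (mem_upEvent (hω _ _ _) (by linarith [hnot'.1]) (by linarith [hnot'.2.1])
      (by linarith [hnot'.2.2]))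
  refine (measure_mono_ae hsub).trans ((measure_union_le _ _).trans ?_)
  refine (add_le_add_left (measure_union_le _ _) _).trans ?_
  rw [siteLaw_edge_set p hp, siteLaw_edge_set p hp, siteLaw_edge_set p hp]
  calc _ ≤ ε + ε + ε := add_le_add (add_le_add h1 h1) h2
    _ = 3 * ε := by ring

/-- The event that the block at `(i, j)` contains a crossing path, going up or down according to the
parity of `i`. -/
def blockEvent (N h : ℕ) (v : ℤ × ℤ) : Set (Config (ℤ × ℤ)) :=
  if Even v.1 then upEvent (v.1 * N) (v.2 * h + (N + h)) N h
  else flip ⁻¹' upEvent (v.1 * N) (-(v.2 * h + (N + h))) N h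

/-- The sites of a block. -/
def blockBox (N h : ℕ) (v : ℤ × ℤ) : Set (ℤ × ℤ) := box (v.1 * N) (v.2 * h + (N + h)) N h

lemma dependsOn_blockEvent (N h : ℕ) (v : ℤ × ℤ) :
    DependsOn (fun ω => ω ∈ blockEvent N h v) (blockBox N h v) := by
  unfold blockEvent
  split_ifs with hv
  · exact dependsOn_upEvent _ _ _ _
  · intro ω ω' hω
    refine dependsOn_upEvent (v.1 * N) (-(v.2 * h + (N + h))) N h (x := flip ω) (y := flip ω')
      fun w hw => hω _ ⟨hw.1, ?_, ?_⟩
    · have := hw.2.2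
      simp only
      linarith
    · have := hw.2.1
      simp only
      linarith

lemma measurableSet_blockEvent (N h : ℕ) (v : ℤ × ℤ) : MeasurableSet (blockEvent N h v) :=
  measurableSet_of_dependsOn_finite (finite_box _ _ _ _) (dependsOn_blockEvent N h v)

lemma siteLaw_blockEvent_compl_le (p : unitInterval) (hp : 0 < (p : ℝ)) {N h : ℕ} {ε : ℝ≥0∞}
    (h1 : siteLaw (ℤ × ℤ) p {ω | (4 * h : ℤ) ≤ edge ω 0 0 N} ≤ ε)
    (h2 : siteLaw (ℤ × ℤ) p {ω | edge ω 0 0 (2 * N) < 6 * h} ≤ ε) (v : ℤ × ℤ) :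
    siteLaw (ℤ × ℤ) p (blockEvent N h v)ᶜ ≤ 3 * ε := by
  unfold blockEvent
  split_ifs with hv
  · exact siteLaw_upEvent_compl_le p hp h1 h2 _ _
  · rw [← Set.preimage_compl]
    refine (Measure.le_map_apply measurable_flip.aemeasurable _).trans ?_
    rw [siteLaw_map_flip]
    exact siteLaw_upEvent_compl_le p hp h1 h2 _ _

/-- The residues that separate the blocks. -/
def blockColour (M : ℕ) (v : ℤ × ℤ) : ZMod 3 × ZMod M := (v.1, v.2)

lemma le_abs_of_intCast_eq {n : ℕ} {a b : ℤ} (h : (a : ZMod n) = b) (hab : a ≠ b) :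
    (n : ℤ) ≤ |a - b| := by
  rw [ZMod.intCast_eq_intCast_iff_dvd_sub, ← dvd_neg, neg_sub] at h
  exact Int.le_of_dvd (abs_pos.2 (sub_ne_zero.2 hab)) ((dvd_abs _ _).2 h)

/-- Blocks of one colour differ by at least 3 in the first index, against a width of `2 N`, or by at
least `2 L + 3` in the second, and `(2 L + 3) h ≥ 2 N + 3 h` exceeds the vertical extent `2 (N +
h)`. -/
lemma disjoint_blockBox {N h L : ℕ} (hN : 0 < N) (hh : 0 < h) (hL : N ≤ L * h) {v w : ℤ × ℤ}
    (hvw : v ≠ w) (hc : blockColour (2 * L + 3) v = blockColour (2 * L + 3) w) :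
    Disjoint (blockBox N h v) (blockBox N h w) := by
  have hc' := Prod.mk.inj hc
  rw [Set.disjoint_left]
  rintro ⟨x, y⟩ hx hy
  obtain ⟨⟨hx1, hx2⟩, hx3, hx4⟩ := hx
  obtain ⟨⟨hy1, hy2⟩, hy3, hy4⟩ := hy
  simp only at hx1 hx2 hx3 hx4 hy1 hy2 hy3 hy4
  have hN' : (0 : ℤ) < N := by exact_mod_cast hN
  have hh' : (0 : ℤ) < h := by exact_mod_cast hh
  have hL' : (N : ℤ) ≤ L * h := by exact_mod_cast hL
  by_cases h1 : v.1 = w.1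
  · have h2 := le_abs_of_intCast_eq hc'.2 fun e => hvw (Prod.ext h1 e)
    push_cast at h2
    rcases le_abs.1 h2 with h3 | h3 <;> nlinarith
  · have h2 := le_abs_of_intCast_eq hc'.1 h1
    push_cast at h2
    rcases le_abs.1 h2 with h3 | h3 <;> nlinarith

lemma measure_forall_mem_le {V ι : Type} (b : V → unitInterval) {A : ι → Set (Config V)}
    {B : ι → Set V} {ε : ℝ≥0∞} (hA : ∀ i, MeasurableSet (A i))
    (hAB : ∀ i, DependsOn (fun ω => ω ∈ A i) (B i)) (hε : ∀ i, productLaw b (A i) ≤ ε)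
    (S : Finset ι) (hS : (S : Set ι).PairwiseDisjoint B) :
    productLaw b {ω | ∀ i ∈ S, ω ∈ A i} ≤ ε ^ S.card := by
  classical
  induction S using Finset.induction_on with
  | empty => simp
  | insert i S hi ih =>
    have h1 : {ω | ∀ j ∈ insert i S, ω ∈ A j} = A i ∩ {ω | ∀ j ∈ S, ω ∈ A j} := by
      ext ω; simp
    have h2 : MeasurableSet {ω | ∀ j ∈ S, ω ∈ A j} := by
      have : {ω | ∀ j ∈ S, ω ∈ A j} = ⋂ j ∈ S, A j := by ext; simp
      rw [this]
      exact S.measurableSet_biInter fun j _ => hA j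
    rw [h1, measure_inter_of_dependsOn b (hA i) h2 (hAB i) (T := ⋃ j ∈ S, B j),
      Finset.card_insert_of_notMem hi, pow_succ']
    · exact mul_le_mul' (hε i) (ih (hS.subset (by simp)))
    · intro x y hxy
      refine propext (forall₂_congr fun j hj => iff_of_eq (hAB j fun v hv => hxy v ?_))
      exact Set.mem_biUnion hj hv
    · rw [Set.disjoint_iUnion₂_right]
      exact fun j hj => hS (by simp) (by simp [hj]) (by rintro rfl; exact hi hj)

/-- The probability that all blocks of a finite set are bad. -/
lemma siteLaw_forall_blockEvent_compl_le (p : unitInterval) {N h L : ℕ} (hN : 0 < N) (hh : 0 < h)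
    (hL : N ≤ L * h) {q : ℝ≥0∞} (hq : q ≤ 1)
    (hε : ∀ v, siteLaw (ℤ × ℤ) p (blockEvent N h v)ᶜ ≤ q ^ (3 * (2 * L + 3)))
    (S : Finset (ℤ × ℤ)) :
    siteLaw (ℤ × ℤ) p {ω | ∀ v ∈ S, ω ∈ (blockEvent N h v)ᶜ} ≤ q ^ S.card := by
  classical
  have : NeZero (2 * L + 3) := ⟨by omega⟩
  set M := 2 * L + 3 with hM
  -- By pigeonhole one of the `3 M` colours contains at least a fraction `1 / (3 M)` of the blocks.
  -- These are independent, which explains the exponent in `hε`.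
  obtain ⟨κ, -, hκ⟩ : ∃ κ ∈ (Finset.univ : Finset (ZMod 3 × ZMod M)),
      S.card ≤ 3 * M * (S.filter fun v => blockColour M v = κ).card := by
    refine Finset.exists_le_of_sum_le Finset.univ_nonempty ?_
    rw [Finset.sum_const, ← Finset.mul_sum,
      ← Finset.card_eq_sum_card_fiberwise (f := blockColour M) fun _ _ => Finset.mem_univ _]
    simp [ZMod.card]
  set S' := S.filter fun v => blockColour M v = κ with hS'
  calc siteLaw (ℤ × ℤ) p {ω | ∀ v ∈ S, ω ∈ (blockEvent N h v)ᶜ}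
      ≤ siteLaw (ℤ × ℤ) p {ω | ∀ v ∈ S', ω ∈ (blockEvent N h v)ᶜ} :=
        measure_mono fun ω hω v hv => hω v (Finset.mem_filter.1 hv).1
    _ ≤ (q ^ (3 * M)) ^ S'.card := by
        refine measure_forall_mem_le (fun _ => p) (B := blockBox N h)
          (fun v => (measurableSet_blockEvent N h v).compl) (fun v x y hxy => ?_) hε S' ?_
        · exact propext (not_congr (iff_of_eq (dependsOn_blockEvent N h v hxy)))
        · intro v hv w hw hvw
          exact disjoint_blockBox hN hh hL hvw
            ((Finset.mem_filter.1 hv).2.trans (Finset.mem_filter.1 hw).2.symm)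
    _ ≤ q ^ S.card := by
        rw [← pow_mul]
        exact pow_le_pow_right_of_le_one' hq hκ

/-! ### Gluing of the paths of the blocks -/

/-- A path across a block, going up or down. -/
lemma exists_path_of_mem_blockEvent {ω : Config (ℤ × ℤ)} {N h : ℕ} {v : ℤ × ℤ}
    (hv : ω ∈ blockEvent N h v) : ∃ f : ℤ → ℤ,
      (∀ x, v.1 * N ≤ x → x < v.1 * N + 2 * N → |f (x + 1) - f x| ≤ 1) ∧
      (∀ x, v.1 * N < x → x ≤ v.1 * N + 2 * N → ω (x, f x) = true) ∧
      |f (v.1 * N + N) - (v.2 * h + (N + h))| ≤ h ∧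
      (∀ x, v.1 * N ≤ x → x ≤ v.1 * N + 2 * N → v.2 * h ≤ f x) ∧
      (Even v.1 → f (v.1 * N) ≤ v.2 * h + (N + h) - 3 * h ∧
        v.2 * h + (N + h) + 3 * h ≤ f (v.1 * N + 2 * N)) ∧
      (¬ Even v.1 → v.2 * h + (N + h) + 3 * h ≤ f (v.1 * N) ∧
        f (v.1 * N + 2 * N) ≤ v.2 * h + (N + h) - 3 * h) := by
  unfold blockEvent at hv
  split_ifs at hv with he
  · obtain ⟨f, hf⟩ := hv
    refine ⟨f, hf.step, hf.isOpen, hf.middle, fun x hx hx' => ?_,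
      fun _ => ⟨hf.left, hf.right⟩, fun h => absurd he h⟩
    have := (abs_le.1 (hf.abs_sub_le hx hx')).1
    linarith
  · obtain ⟨f, hf⟩ := hv
    refine ⟨fun x => -f x, fun x hx hx' => ?_, fun x hx hx' => hf.isOpen x hx hx', ?_,
      fun x hx hx' => ?_, fun h => absurd h he, fun _ => ⟨?_, ?_⟩⟩
    · have := abs_le.1 (hf.step x hx hx')
      rw [abs_le]
      constructor <;> linarith
    · have := abs_le.1 hf.middle
      rw [abs_le]
      constructor <;> linarith
    · have := (abs_le.1 (hf.abs_sub_le hx hx')).2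
      linarith
    · linarith [hf.left]
    · linarith [hf.right]

/-- A Lipschitz function of good blocks gives an open Lipschitz function. -/
lemma mem_lipschitzEvent_of_blocks {ω : Config (ℤ × ℤ)} {N h : ℕ} (hN : 0 < N) (hh : 0 < h)
    {G : ℤ → ℤ} (hG0 : ∀ i, 0 < G i) (hG1 : ∀ i, |G (i + 1) - G i| ≤ 1)
    (hG : ∀ i, ω ∈ blockEvent N h (i, G i)) : ω ∈ lipschitzEvent := by
  have hN' : (0 : ℤ) < N := by exact_mod_cast hN
  have hh' : (0 : ℤ) < h := by exact_mod_cast hh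
  choose f hstep hopen hmid hpos heven hodd using fun i => exists_path_of_mem_blockEvent (hG i)
  simp only at hstep hopen hmid hpos heven hodd
  have hGh : ∀ i, |G (i + 1) * h - G i * h| ≤ h := by
    intro i
    rw [← sub_mul, abs_mul, abs_of_pos hh']
    exact mul_le_of_le_one_left hh'.le (hG1 i)
  -- On the overlap of blocks `k` and `k + 1`, the maximum is used if block `k + 1` goes up and
  -- block `k` down, the minimum in the opposite case. Centres differ by at most `h` and midpoints
  -- deviate by at most `h`, whereas the ends are `3 h` away. So `g k` equals `f k` on the left, at
  -- the midpoint of block `k`, and `f (k + 1)` on the right, at the midpoint of block `k + 1`.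
  set g : ℤ → ℤ → ℤ := fun k x =>
    if Even (k + 1) then max (f k x) (f (k + 1) x) else min (f k x) (f (k + 1) x) with hg
  have hleft : ∀ k, g k ((k + 1) * N) = f k ((k + 1) * N) := by
    intro k
    have h1 := abs_le.1 (hmid k)
    have h2 := abs_le.1 (hGh k)
    rw [show k * (N : ℤ) + N = (k + 1) * N by ring] at h1
    simp only [hg]
    split_ifs with he
    · exact max_eq_left (by linarith [(heven (k + 1) he).1])
    · exact min_eq_left (by linarith [(hodd (k + 1) he).1])
  have hright : ∀ k, g k ((k + 1 + 1) * N) = f (k + 1) ((k + 1 + 1) * N) := by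
    intro k
    have h1 := abs_le.1 (hmid (k + 1))
    have h2 := abs_le.1 (hGh k)
    rw [show (k + 1) * (N : ℤ) + N = (k + 1 + 1) * N by ring] at h1
    simp only [hg]
    split_ifs with he
    · have := (hodd k (by rw [Int.even_add_one] at he; exact he)).2
      rw [show k * (N : ℤ) + 2 * N = (k + 1 + 1) * N by ring] at this
      exact max_eq_right (by linarith)
    · have := (heven k (by rw [Int.even_add_one, not_not] at he; exact he)).2
      rw [show k * (N : ℤ) + 2 * N = (k + 1 + 1) * N by ring] at this
      exact min_eq_right (by linarith)
  have hgstep : ∀ k x : ℤ, (k + 1) * N ≤ x → x < (k + 1 + 1) * N → |g k (x + 1) - g k x| ≤ 1 := by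
    intro k x hx hx'
    have h1 := abs_le.1 (hstep k x (by linarith) (by linarith))
    have h2 := abs_le.1 (hstep (k + 1) x hx (by linarith))
    simp only [hg]
    rw [abs_le]
    split_ifs <;> omega
  have hgopen : ∀ k x : ℤ, (k + 1) * N ≤ x → x < (k + 1 + 1) * N → ω (x, g k x) = true := by
    intro k x hx hx'
    -- The initial site of a crossing need not be open, but at the left end `g k` follows `f k`.
    rcases hx.eq_or_lt with rfl | hlt
    · rw [hleft]
      exact hopen k _ (by linarith) (by linarith)
    · have h1 := hopen k x (by linarith) (by linarith)
      have h2 := hopen (k + 1) x hlt (by linarith)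
      simp only [hg]
      split_ifs
      · rcases max_choice (f k x) (f (k + 1) x) with e | e <;> rw [e] <;> assumption
      · rcases min_choice (f k x) (f (k + 1) x) with e | e <;> rw [e] <;> assumption
  -- The shift of the block centres by `N + h` keeps the path of block `i` at or above height `G i *
  -- h`, which is positive.
  have hgpos : ∀ k x : ℤ, (k + 1) * N ≤ x → x < (k + 1 + 1) * N → 0 < g k x := by
    intro k x hx hx'
    have h1 := hpos k x (by linarith) (by linarith)
    have h2 := hpos (k + 1) x hx (by linarith)
    have h3 := mul_pos (hG0 k) hh'
    have h4 := mul_pos (hG0 (k + 1)) hh'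
    simp only [hg]
    split_ifs <;> omega
  have hdiv : ∀ x : ℤ, (x / N - 1 + 1) * N ≤ x ∧ x < (x / N - 1 + 1 + 1) * N := by
    intro x
    have h1 := Int.mul_ediv_add_emod x N
    have h2 := Int.emod_nonneg x hN'.ne'
    have h3 := Int.emod_lt_of_pos x hN'
    constructor <;> nlinarith
  refine ⟨fun x => g (x / N - 1) x, fun x => hgpos _ x (hdiv x).1 (hdiv x).2, fun x => ?_,
    fun x => hgopen _ x (hdiv x).1 (hdiv x).2⟩
  set k := x / (N : ℤ) - 1 with hk
  obtain ⟨h1, h2⟩ := hdiv x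
  rw [← hk] at h1 h2
  have h3 := hgstep k x h1 h2
  rcases (Int.add_one_le_iff.2 h2).lt_or_eq with hlt | heq
  · have : (x + 1) / (N : ℤ) - 1 = k := by
      have : (x + 1) / (N : ℤ) = k + 1 :=
        Int.ediv_eq_iff_of_pos hN' |>.2 ⟨by linarith, by linarith⟩
      linarith
    simp only [this]
    exact h3
  · have : (x + 1) / (N : ℤ) - 1 = k + 1 := by
      rw [heq, Int.mul_ediv_cancel _ hN'.ne']
      ring
    simp only [this]
    rw [heq, hright] at h3
    rw [heq, hleft]
    exact h3

/-- Open Lipschitz functions exist if the edge has positive speed. -/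
theorem ae_mem_lipschitzEvent_of_speed (p : unitInterval) (hp : 0 < (p : ℝ)) {c : ℝ} (hc : 0 < c)
    (hspeed : ∀ n : ℕ, c * n ≤ meanEdge p n) :
    ∀ᵐ ω ∂siteLaw (ℤ × ℤ) p, ω ∈ lipschitzEvent := by
  classical
  obtain ⟨L, hL⟩ := exists_edge_concentration p hp hc hspeed
  set q : ℝ≥0∞ := ENNReal.ofReal (1 / 8) with hq
  have hq1 : q ≤ 1 := by rw [hq, ENNReal.ofReal_le_one]; norm_num
  -- A block is bad with probability at most `3 ε`, and this `ε` makes it `q ^ (3 * (2 * L + 3))`.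
  obtain ⟨N, h, hN, hh, hNL, h1, h2⟩ := hL ((1 / 8) ^ (3 * (2 * L + 3)) / 3) (by positivity)
  have hε : ∀ v, siteLaw (ℤ × ℤ) p (blockEvent N h v)ᶜ ≤ q ^ (3 * (2 * L + 3)) := by
    intro v
    refine (siteLaw_blockEvent_compl_le p hp h1 h2 v).trans (le_of_eq ?_)
    rw [show (3 : ℝ≥0∞) = ENNReal.ofReal 3 by simp, ← ENNReal.ofReal_mul (by norm_num), hq,
      ← ENNReal.ofReal_pow (by norm_num)]
    congr 1
    ring
  -- Only the probability that blocks are bad is controlled, so good blocks get weight 1. The block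
  -- configuration is dependent, but the Peierls argument needs only this bound on cylinders.
  have hpeierls := ae_mem_lipschitzEvent (μ := siteLaw (ℤ × ℤ) p)
    (β := fun ω v => decide (ω ∈ blockEvent N h v)) (q := q) (p := ENNReal.ofReal 1)
    (by
      rw [hq, show (2 : ℝ≥0∞) = ENNReal.ofReal 2 by simp, ← ENNReal.ofReal_mul zero_le_two,
        ← ENNReal.ofReal_one, ENNReal.ofReal_lt_ofReal_iff one_pos]
      norm_num)
    (climbSum_mul_lt_one (by norm_num) (by norm_num) (by norm_num))
    (fun S T _ => by
      refine (measure_mono fun ω hω => ?_).trans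
        ((siteLaw_forall_blockEvent_compl_le p hN hh hNL hq1 hε S).trans (by simp))
      exact fun v hv => by simpa using hω.1 v hv)
  filter_upwards [hpeierls] with ω ⟨G, hG0, hG1, hG⟩
  exact mem_lipschitzEvent_of_blocks hN hh hG0 hG1 fun i => by simpa using hG i

/-! ### The critical probabilities -/

/-- The mean displacement of the edge in one step is negative if most of the sites are closed. -/
lemma meanEdge_one_neg (p : unitInterval) (hp : 0 < (p : ℝ)) (hp2 : (p : ℝ) < 1 / 2) :
    meanEdge p 1 < 0 := by
  have hq0 : (0 : ℝ) ≤ 1 - p := by linarith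
  -- `1 - edge` is the number of closed sites at the top of column 1, counted down from height 1.
  -- Its mean is `∑ (1 - p) ^ (i + 1) = (1 - p) / p > 1`; finitely many terms suffice.
  have hB : ∃ B : ℕ, 1 < ∑ i ∈ Finset.range B, (1 - p : ℝ) ^ (i + 1) := by
    have h1 := (hasSum_geometric_of_lt_one hq0 (by linarith : (1 - p : ℝ) < 1)).mul_left (1 - p : ℝ)
    have h2 : 1 < (1 - (p : ℝ)) * (1 - (1 - (p : ℝ)))⁻¹ := by
      rw [sub_sub_cancel, ← div_eq_mul_inv, lt_div_iff₀ hp]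
      linarith
    obtain ⟨B, hB⟩ := (h1.tendsto_sum_nat.eventually (lt_mem_nhds h2)).exists
    exact ⟨B, by simpa [pow_succ'] using hB⟩
  obtain ⟨B, hB⟩ := hB
  set S : ℕ → Set (Config (ℤ × ℤ)) := fun i => {ω | ∀ j ≤ i, ω (1, 1 - (j : ℤ)) = false} with hS
  have hSm : ∀ i, MeasurableSet (S i) := by
    intro i
    have : S i = ⋂ j, ⋂ _ : j ≤ i, {ω | ω (1, 1 - (j : ℤ)) = false} := by ext; simp [hS]
    rw [this]
    exact MeasurableSet.iInter fun j => MeasurableSet.iInter fun _ =>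
      measurableSet_eq_fun (measurable_pi_apply _) measurable_const
  have hSp : ∀ i, (siteLaw (ℤ × ℤ) p).real (S i) = (1 - p : ℝ) ^ (i + 1) := by
    intro i
    have := siteLaw_cylinder p (V := ℤ × ℤ)
      ((Finset.range (i + 1)).image fun j : ℕ => ((1, 1 - j) : ℤ × ℤ)) ∅ (by simp)
    rw [Finset.card_image_of_injective _ fun i j hij => by simpa using hij, Finset.card_range,
      Finset.card_empty, pow_zero, mul_one, ← ENNReal.ofReal_pow hq0] at this
    rw [measureReal_def, show S i = {ω | (∀ v ∈ (Finset.range (i + 1)).image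
      fun j : ℕ => ((1, 1 - j) : ℤ × ℤ), ω v = false) ∧ ∀ v ∈ (∅ : Finset (ℤ × ℤ)), ω v = true} by
        ext ω; simp [hS], this, ENNReal.toReal_ofReal (by positivity)]
  have hpt : ∀ᵐ ω ∂siteLaw (ℤ × ℤ) p, (edge ω 0 0 1 : ℝ) ≤
      1 - ∑ i ∈ Finset.range B, (S i).indicator (fun _ => (1 : ℝ)) ω := by
    filter_upwards [ae_wet_nonempty p hp] with ω hω
    have hmem := edge_mem (hω 0 0 1)
    have hle := edge_le (hω 0 0 1)
    set e := edge ω 0 0 1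
    have hopen : ω (1, e) = true := by simpa using hmem.1
    have h1 : ∑ i ∈ Finset.range B, (S i).indicator (fun _ => (1 : ℝ)) ω ≤ ((1 - e).toNat : ℝ) := by
      calc _ ≤ ∑ i ∈ Finset.range B, if i < (1 - e).toNat then (1 : ℝ) else 0 := by
            refine Finset.sum_le_sum fun i _ => ?_
            split_ifs with hi
            · exact Set.indicator_le_self' (fun _ _ => zero_le_one) _
            · rw [Set.indicator_of_notMem]
              intro hmem
              have := hmem (1 - e).toNat (not_lt.1 hi)
              rw [show (1 : ℤ) - ((1 - e).toNat : ℤ) = e by push_cast at hle; omega, hopen] at this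
              exact Bool.noConfusion this
        _ = (((Finset.range B).filter fun i => i < (1 - e).toNat).card : ℝ) := by simp
        _ ≤ _ := by
            have : ((Finset.range B).filter fun i => i < (1 - e).toNat) ⊆
                Finset.range (1 - e).toNat := fun i hi =>
              Finset.mem_range.2 (Finset.mem_filter.1 hi).2
            have := Finset.card_le_card this
            rw [Finset.card_range] at this
            exact_mod_cast this
    have h2 : (((1 - e).toNat : ℤ) : ℝ) = 1 - e := by
      rw [Int.toNat_of_nonneg (by push_cast at hle; omega)]
      push_cast
      ring
    rw [Int.cast_natCast] at h2
    linarith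
  have hi : ∀ i, Integrable ((S i).indicator fun _ => (1 : ℝ)) (siteLaw (ℤ × ℤ) p) := fun i =>
    (integrable_const _).indicator (hSm i)
  have hint := integral_mono_ae
    (g := fun ω => 1 - ∑ i ∈ Finset.range B, (S i).indicator (fun _ => (1 : ℝ)) ω)
    (integrable_edge p hp 0 0 1)
    ((integrable_const (1 : ℝ)).sub (integrable_finsetSum _ fun i _ => hi i)) hpt
  rw [integral_sub (integrable_const _) (integrable_finsetSum _ fun i _ => hi i),
    integral_finsetSum _ fun i _ => hi i] at hint
  simp only [integral_indicator_const _ (hSm _), hSp, smul_eq_mul, mul_one, integral_const,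
    probReal_univ] at hint
  rw [meanEdge]
  linarith

/-! ### Comparison of the critical probabilities -/

/-- The two-dimensional lattice of `pL` is `ℤ × ℤ`. -/
lemma mem_lipEvent_two_iff (ω : Config ((Fin (2 - 1) → ℤ) × ℤ)) :
    ω ∈ lipEvent 2 ↔
      (fun v : ℤ × ℤ => ω ((fun _ => v.1), v.2)) ∈ lipschitzEvent := by
  have : Subsingleton (Fin (2 - 1)) := inferInstanceAs (Subsingleton (Fin 1))
  have hconst : ∀ x : Fin (2 - 1) → ℤ, (fun _ => x 0) = x := fun x => by
    funext i
    rw [Subsingleton.elim i 0]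
  constructor
  · rintro ⟨F, ⟨hF0, hF1⟩, hF⟩
    refine ⟨fun x => F fun _ => x, fun x => hF0 _, fun x => hF1 _ _ ?_, fun x => hF _⟩
    simp [l1norm]
  · rintro ⟨F, hF0, hF1, hF⟩
    refine ⟨fun x => F (x 0), ⟨fun x => hF0 _, fun x y hxy => ?_⟩, fun x => ?_⟩
    · have h1 : |x 0 - y 0| = 1 := by simpa [l1norm] using hxy
      change |F (x 0) - F (y 0)| ≤ 1
      rcases (abs_eq zero_le_one).1 h1 with h | h
      · rw [show x 0 = y 0 + 1 by linarith]
        exact hF1 _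
      · rw [show y 0 = x 0 + 1 by linarith, abs_sub_comm]
        exact hF1 _
    · simpa only [hconst x] using hF (x 0)

lemma siteLaw_lipEvent_eq_one_iff (p : unitInterval) :
    siteLaw ((Fin (2 - 1) → ℤ) × ℤ) p (lipEvent 2) = 1 ↔
      siteLaw (ℤ × ℤ) p lipschitzEvent = 1 := by
  have : Unique (Fin (2 - 1)) := inferInstanceAs (Unique (Fin 1))
  let e : (Fin (2 - 1) → ℤ) × ℤ ≃ ℤ × ℤ :=
    (Equiv.funUnique (Fin (2 - 1)) ℤ).prodCongr (Equiv.refl ℤ)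
  have hmeas : (siteLaw ((Fin (2 - 1) → ℤ) × ℤ) p).map
      (MeasurableEquiv.piCongrLeft (fun _ : ℤ × ℤ => Bool) e) = siteLaw (ℤ × ℤ) p :=
    Measure.infinitePi_map_piCongrLeft (μ := fun _ : ℤ × ℤ => bernoulliMeasure true false p) e
  rw [← hmeas, MeasurableEquiv.map_apply]
  congr! 2
  ext ω
  rw [mem_lipEvent_two_iff, Set.mem_preimage]
  congr! 1

/-- If there are open Lipschitz functions, then there is percolation. -/
lemma siteLaw_infinitePathEvent_ne_zero (p : unitInterval)
    (h : siteLaw (ℤ × ℤ) p lipschitzEvent = 1) :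
    siteLaw (ℤ × ℤ) p (infinitePathEvent altLattice (0, 0)) ≠ 0 := by
  intro h0
  have hsub : lipschitzEvent ⊆ ⋃ k : ℤ, shift 0 k ⁻¹' infinitePathEvent altLattice (0, 0) := by
    rintro ω ⟨F, -, hF1, hF⟩
    refine Set.mem_iUnion.2 ⟨F 0, fun n => (n, F n - F 0), fun m n hmn => ?_, by simp, fun n => ?_,
      fun n => ?_⟩
    · simpa using (Prod.mk.inj hmn).1
    · rw [altLattice_adj_iff]
      refine ⟨by simp, ?_⟩
      simpa using hF1 n
    · simpa [shift] using hF n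
  have h1 : siteLaw (ℤ × ℤ) p lipschitzEvent ≤ 0 := by
    refine (measure_mono hsub).trans ((measure_iUnion_le _).trans ?_)
    rw [nonpos_iff_eq_zero, ENNReal.tsum_eq_zero]
    intro k
    refine le_antisymm ((Measure.le_map_apply (measurable_shift 0 k).aemeasurable _).trans ?_)
      zero_le
    rw [siteLaw_map_shift, h0]
  rw [h] at h1
  exact absurd h1 (by simp)

lemma siteLaw_lipschitzEvent_eq_one {p : unitInterval}
    (h : ∀ᵐ ω ∂siteLaw (ℤ × ℤ) p, ω ∈ lipschitzEvent) : siteLaw (ℤ × ℤ) p lipschitzEvent = 1 := by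
  exact (measure_congr (eventuallyEq_univ.2 h)).trans measure_univ

/-- If there is percolation, then there are open Lipschitz functions at all larger densities. -/
lemma siteLaw_lipschitzEvent_of_lt {p p' : unitInterval} (hp : 0 < (p : ℝ)) (hpp : p < p')
    (h : siteLaw (ℤ × ℤ) p (infinitePathEvent altLattice (0, 0)) ≠ 0) :
    siteLaw (ℤ × ℤ) p' lipschitzEvent = 1 := by
  have hpp' : (p : ℝ) < p' := hpp
  refine siteLaw_lipschitzEvent_eq_one
    (ae_mem_lipschitzEvent_of_speed p' (hp.trans hpp') (sub_pos.2 hpp') fun n => ?_)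
  have h1 : 0 ≤ meanEdge p n := by
    by_contra hneg
    exact h (siteLaw_infinitePathEvent_eq_zero p hp (not_le.1 hneg))
  linarith [meanEdge_add_le hp hpp n]

/-- There is no percolation if all the sites are closed. -/
lemma siteLaw_zero_infinitePathEvent :
    siteLaw (ℤ × ℤ) 0 (infinitePathEvent altLattice (0, 0)) = 0 := by
  have h := siteLaw_cylinder (0 : unitInterval) (V := ℤ × ℤ) ∅ {(0, 0)} (by simp)
  refine measure_mono_null (fun ω hω => ?_) (h.trans (by simp))
  obtain ⟨γ, -, h0, -, hγ⟩ := hω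
  have := hγ 0
  rw [h0] at this
  simpa using this

lemma pL_two_eq : pL 2 =
    sInf ((fun p : unitInterval => (p : ℝ)) '' {p | siteLaw (ℤ × ℤ) p lipschitzEvent = 1}) := by
  simp only [pL, siteLaw_lipEvent_eq_one_iff]

lemma pL_two_le {p : unitInterval} (h : siteLaw (ℤ × ℤ) p lipschitzEvent = 1) :
    pL 2 ≤ p := by
  rw [pL_two_eq]
  exact csInf_le ⟨0, by rintro _ ⟨p, -, rfl⟩; exact p.2.1⟩ ⟨p, h, rfl⟩

lemma le_pAlt {p : unitInterval}
    (h : siteLaw (ℤ × ℤ) p (infinitePathEvent altLattice (0, 0)) = 0) : (p : ℝ) ≤ pAlt :=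
  le_csSup ⟨1, by rintro _ ⟨p, -, rfl⟩; exact p.2.2⟩ ⟨p, h, rfl⟩

lemma half_le_pAlt : 1 / 2 ≤ pAlt := by
  refine le_of_forall_lt fun c hc => ?_
  obtain ⟨x, hx, hx2⟩ := exists_between (max_lt hc (by norm_num : (0 : ℝ) < 1 / 2))
  have hx0 : 0 < x := (le_max_right _ _).trans_lt hx
  let p : unitInterval := ⟨x, hx0.le, by linarith⟩
  exact ((le_max_left _ _).trans_lt hx).trans_le
    (le_pAlt (siteLaw_infinitePathEvent_eq_zero p hx0 (meanEdge_one_neg p hx0 hx2)))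

lemma pL_two_le_decimal : pL 2 ≤ 0.7491 := by
  refine le_of_forall_gt fun c hc => ?_
  obtain ⟨x, hx, hx2⟩ := exists_between (lt_min hc (by norm_num : (0.7491 : ℝ) < 1))
  have hx0 : 0 < x := lt_trans (by norm_num) hx
  let p : unitInterval := ⟨x, hx0.le, (hx2.trans_le (min_le_right _ _)).le⟩
  exact (pL_two_le (p := p)
    (siteLaw_lipschitzEvent_eq_one (ae_mem_lipschitzEvent_of_lt hx))).trans_lt
    (hx2.trans_le (min_le_left _ _))

/-- If `q < p` had Lipschitz functions at `q` but no percolation at `p`, then percolation at `q`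
would give Lipschitz functions at `p` by sprinkling, hence percolation at `p`. Sprinkling takes the
place of monotonicity. -/
lemma pAlt_le_pL_two : pAlt ≤ pL 2 := by
  rw [pL_two_eq]
  refine csSup_le ⟨_, 0, siteLaw_zero_infinitePathEvent, rfl⟩ ?_
  rintro _ ⟨p, hp, rfl⟩
  refine le_csInf ⟨_, 1, siteLaw_lipschitzEvent_eq_one
    (ae_mem_lipschitzEvent_of_lt (by norm_num)), rfl⟩ ?_
  rintro _ ⟨q, hq, rfl⟩
  by_contra! hqp
  have hq' := siteLaw_infinitePathEvent_ne_zero q hq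
  have hq0 : 0 < (q : ℝ) := by
    refine lt_of_le_of_ne q.2.1 fun h => hq' ?_
    rw [show q = 0 from Subtype.ext h.symm]
    exact siteLaw_zero_infinitePathEvent
  exact siteLaw_infinitePathEvent_ne_zero p (siteLaw_lipschitzEvent_of_lt hq0 hqp hq') hp

/-- Between the two values choose `x < y`. Percolation occurs at `x`, so Lipschitz functions exist
at `y`, below their threshold. The numerical bounds serve only to place `x` and `y` in the unit
interval. -/
lemma pL_two_le_pAlt : pL 2 ≤ pAlt := by
  by_contra! hlt
  obtain ⟨x, hx, hx2⟩ := exists_between hlt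
  obtain ⟨y, hy, hy2⟩ := exists_between hx2
  have h0 := half_le_pAlt
  have h1 := pL_two_le_decimal
  let p : unitInterval := ⟨x, by linarith, by linarith⟩
  let q : unitInterval := ⟨y, by linarith, by linarith⟩
  refine hy2.not_ge (pL_two_le (p := q) ?_)
  refine siteLaw_lipschitzEvent_of_lt (p := p) (show 0 < x by linarith) (show x < y from hy) ?_
  exact fun h => hx.not_ge (le_pAlt h)

end LipschitzPercolation

end

open LipschitzPercolation in
theorem proposition5p2 :
    LipschitzPercolation.pL 2 = LipschitzPercolation.pAlt ∧
      1 / 2 ≤ LipschitzPercolation.pAlt ∧ LipschitzPercolation.pAlt ≤ 0.7491 := by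
  have h := le_antisymm pL_two_le_pAlt pAlt_le_pL_two
  exact ⟨h, half_le_pAlt, h ▸ pL_two_le_decimal⟩
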